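/- Let $\mu>-\tfrac12$ and let $d\lambda_\mu(x)=|x|^{2\mu}e^{-x^2}\,dx$ on $\mathbb{R}$. For $\alpha>-1$ let $L_m^{\alpha}(x)=\sum_{k=0}^m(-1)^k\frac{\Gamma(m+\alpha+1)}{\Gamma(k+\alpha+1)\,(m-k)!}\,\frac{x^k}{k!}$ be the Laguerre polynomials, and define the generalized Hermite polynomials and the generalized factorial by $$H_{2m}^{\mu}(x)=(-1)^m(2m)!\,\frac{\Gamma(\mu+\frac12)}{\Gamma(m+\mu+\frac12)}\,L_m^{\mu-\frac12}(x^2),\qquad H_{2m+1}^{\mu}(x)=(-1)^m(2m+1)!\,\frac{\Gamma(\mu+\frac12)}{\Gamma(m+\mu+\frac32)}\,x\,L_m^{\mu+\frac12}(x^2),$$ $$\gamma_\mu(2m)=\frac{2^{2m}\,m!\,\Gamma(m+\mu+\frac12)}{\Gamma(\mu+\frac12)},\qquad \gamma_\mu(2m+1)=\frac{2^{2m+1}\,m!\,\Gamma(m+\mu+\frac32)}{\Gamma(\mu+\frac12)}.$$ For $t>0$ and $x\in\mathbb{R}$ the generalized Ornstein-Uhlenbeck semigroup and its maximal function are $$T_\mu^tf(x)=\int_{\mathbb{R}}\Big(\sum_{n=0}^\infty\frac{\gamma_\mu(n)}{2^n(n!)^2\,\Gamma(\mu+\frac12)}\,H_n^\mu(x)H_n^\mu(y)\,e^{-nt}\Big)f(y)\,d\lambda_\mu(y),\qquad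 T_\mu^*f(x)=\sup_{t>0}|T_\mu^tf(x)|.$$ Then for every $1<p\le\infty$ there is a constant $C<\infty$, depending only on $\mu$ and $p$, such that for every real- or complex-valued $f\in L^p(d\lambda_\mu)$ $$\|T_\mu^*f\|_{L^p(d\lambda_\mu)}\le C\,\|f\|_{L^p(d\lambda_\mu)}.$$ Here, for all $t>0$ and $x,y\in\mathbb{R}$, the series and the integral defining $T_\mu^tf(x)$ converge absolutely, and $T_\mu^*f$ is $\lambda_\mu$-measurable. -/

import Mathlib

open MeasureTheory
open scoped ENNReal NNReal

noncomputable section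

namespace GenOU

/-- The measure `dλ_μ(x) = |x|^{2μ} e^{-x²} dx` on `ℝ`. -/
def lam (μ : ℝ) : Measure ℝ :=
  volume.withDensity fun x => ENNReal.ofReal (|x| ^ (2 * μ) * Real.exp (-x ^ 2))

/-- The Laguerre polynomial `L_m^α(x) = ∑_{k ≤ m} (-1)^k binom(m + α, m - k) x^k / k!`
(for `α > -1`), the binomial coefficient being written with Gamma functions. -/
def laguerre (α : ℝ) (m : ℕ) (x : ℝ) : ℝ :=
  ∑ k ∈ Finset.range (m + 1),
    (-1) ^ k * (Real.Gamma (m + α + 1) /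
      (Real.Gamma (k + α + 1) * ((m - k).factorial : ℝ))) * (x ^ k / (k.factorial : ℝ))

/-- The generalized factorial `γ_μ(n)`, where `n = 2m` or `n = 2m + 1` with `m = n / 2`. -/
def genFactorial (μ : ℝ) (n : ℕ) : ℝ :=
  if Even n then
    2 ^ n * ((n / 2).factorial : ℝ) * Real.Gamma ((n / 2 : ℕ) + μ + 1 / 2) /
      Real.Gamma (μ + 1 / 2)
  else
    2 ^ n * ((n / 2).factorial : ℝ) * Real.Gamma ((n / 2 : ℕ) + μ + 3 / 2) /
      Real.Gamma (μ + 1 / 2)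

/-- The generalized Hermite polynomial `H_n^μ` (in Rosenblum's normalization),
where `n = 2m` or `n = 2m + 1` with `m = n / 2`. -/
def genHermite (μ : ℝ) (n : ℕ) (x : ℝ) : ℝ :=
  if Even n then
    (-1) ^ (n / 2) * (n.factorial : ℝ) *
      (Real.Gamma (μ + 1 / 2) / Real.Gamma ((n / 2 : ℕ) + μ + 1 / 2)) *
        laguerre (μ - 1 / 2) (n / 2) (x ^ 2)
  else
    (-1) ^ (n / 2) * (n.factorial : ℝ) *
      (Real.Gamma (μ + 1 / 2) / Real.Gamma ((n / 2 : ℕ) + μ + 3 / 2)) *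
        (x * laguerre (μ + 1 / 2) (n / 2) (x ^ 2))

/-- The `n`-th term `e^{-nt} H_n^μ(x) H_n^μ(y) / ‖H_n^μ‖²` of the kernel of the semigroup; here
`‖H_n^μ‖² = 2^n (n!)² Γ(μ + 1/2) / γ_μ(n)` is the squared norm in `L²(dλ_μ)`. -/
def kernelTerm (μ t x y : ℝ) (n : ℕ) : ℝ :=
  genFactorial μ n / (2 ^ n * (n.factorial : ℝ) ^ 2 * Real.Gamma (μ + 1 / 2)) *
    genHermite μ n x * genHermite μ n y * Real.exp (-(n * t))

/-- The density with respect to `λ_μ(dy)` of the kernel `P_t(x, dy)` of the generalized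
Ornstein-Uhlenbeck semigroup. -/
def kernel (μ t x y : ℝ) : ℝ :=
  ∑' n : ℕ, kernelTerm μ t x y n

/-- The generalized Ornstein-Uhlenbeck semigroup `T_μ^t f(x) = ∫ f(y) P_t(x, dy)`. -/
def semigroup {𝕜 : Type*} [RCLike 𝕜] (μ t : ℝ) (f : ℝ → 𝕜) (x : ℝ) : 𝕜 :=
  ∫ y, kernel μ t x y • f y ∂(lam μ)

/-- The maximal function `T_μ^* f(x) = sup_{t > 0} |T_μ^t f(x)|`, with values in `[0, ∞]`. -/
def maximal {𝕜 : Type*} [RCLike 𝕜] (μ : ℝ) (f : ℝ → 𝕜) (x : ℝ) : ℝ≥0∞ :=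
  ⨆ (t : ℝ) (_ : 0 < t), ‖semigroup μ t f x‖ₑ

end GenOU

end

/-!
Split the kernel of `T_μ^t` into its parts of even and odd index. By the Hille–Hardy formula, each
is an elementary factor times a modified Bessel series, of order `μ - 1/2` for the even part and
`μ + 1/2` for the odd part. Hence the even part is positive and, comparing the two Bessel series
term by term, it dominates the odd part up to a constant independent of `t`, `x`, `y`.

The even part is a semigroup of Markov kernels reversible with respect to `λ_μ`: orthogonality of
the Laguerre polynomials gives the Chapman–Kolmogorov equation, and the total mass is `1`. For such
a semigroup Rota's inequality bounds the maximal function over `t ∈ {2ns : n ∈ ℕ}` in `L^p` with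
the constant `p / (p - 1)` for every step `s`, hence the maximal function over all dyadic times; by
continuity in `t` these suffice for the supremum over all `t > 0`.
-/

noncomputable section

namespace GenOU

open ProbabilityTheory Finset Filter
open scoped Topology

/-! ### The maximal inequality for reversible Markov kernels -/

section Rota

theorem add_rpow_le_rpow_add_mul {q a b : ℝ} (hq : 1 ≤ q) (ha : 0 ≤ a) (hb : 0 ≤ b) :
    (a + b) ^ q ≤ a ^ q + q * ((a + b) ^ (q - 1) * b) := by
  rcases (add_nonneg ha hb).eq_or_lt with h0 | hc
  · obtain ⟨rfl, rfl⟩ : a = 0 ∧ b = 0 := ⟨by linarith, by linarith⟩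
    simp
  have bernoulli : 1 + q * (-b / (a + b)) ≤ (1 + -b / (a + b)) ^ q :=
    one_add_mul_self_le_rpow_one_add (by rw [le_div_iff₀ hc]; linarith) hq
  rw [show 1 + -b / (a + b) = a / (a + b) by field_simp; ring, Real.div_rpow ha hc.le,
    le_div_iff₀ (Real.rpow_pos_of_pos hc q)] at bernoulli
  have hpow : (a + b) ^ q = (a + b) ^ (q - 1) * (a + b) := by
    rw [Real.rpow_sub_one hc.ne']; field_simp
  have hexpand : (1 + q * (-b / (a + b))) * (a + b) ^ q =
      (a + b) ^ q - q * ((a + b) ^ (q - 1) * b) := by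
    rw [hpow]; field_simp; ring
  linarith

theorem ennreal_add_rpow_le_rpow_add_mul {q : ℝ} (hq : 1 ≤ q) (a b : ℝ≥0∞) :
    (a + b) ^ q ≤ a ^ q + ENNReal.ofReal q * ((a + b) ^ (q - 1) * b) := by
  have hq0 : 0 < q := by linarith
  rcases eq_or_ne a ∞ with rfl | ha
  · simp [ENNReal.top_rpow_of_pos hq0]
  rcases eq_or_ne b ∞ with rfl | hb
  · have h1 : (∞ : ℝ≥0∞) ^ (q - 1) ≠ 0 := by
      rcases hq.eq_or_lt with rfl | h
      · simp
      · simp [ENNReal.top_rpow_of_pos (sub_pos.2 h)]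
    have h2 : ENNReal.ofReal q ≠ 0 := by simpa using hq0
    simp [ENNReal.mul_top h1, ENNReal.mul_top h2]
  lift a to ℝ≥0 using ha
  lift b to ℝ≥0 using hb
  have key : (a + b) ^ q ≤ a ^ q + q.toNNReal * ((a + b) ^ (q - 1) * b) := by
    rw [← NNReal.coe_le_coe]
    push_cast
    rw [Real.coe_toNNReal q hq0.le]
    exact add_rpow_le_rpow_add_mul hq a.2 b.2
  rw [← ENNReal.coe_add, ← ENNReal.coe_rpow_of_nonneg _ hq0.le,
    ← ENNReal.coe_rpow_of_nonneg _ hq0.le, ← ENNReal.coe_rpow_of_nonneg _ (sub_nonneg.2 hq),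
    ENNReal.ofReal]
  exact_mod_cast key

variable {X : Type*} [MeasurableSpace X] {κ η : Kernel X X} {π : Measure X} {f g : X → ℝ≥0∞}

/-- The averaging operator `f ↦ ∫ f(y) κ(·, dy)` of a transition kernel. -/
def avg (κ : Kernel X X) (f : X → ℝ≥0∞) (x : X) : ℝ≥0∞ := ∫⁻ y, f y ∂κ x

@[fun_prop]
theorem measurable_avg (hf : Measurable f) : Measurable (avg κ f) := hf.lintegral_kernel

theorem avg_mono (h : f ≤ g) : avg κ f ≤ avg κ g := fun _ => lintegral_mono h

theorem avg_le_const [IsMarkovKernel κ] {c : ℝ≥0∞} (h : ∀ x, f x ≤ c) (x : X) :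
    avg κ f x ≤ c :=
  (lintegral_mono h).trans (by simp)

theorem avg_comp (hf : Measurable f) : avg (η ∘ₖ κ) f = avg κ (avg η f) :=
  funext fun x => Kernel.lintegral_comp η κ x hf

theorem avg_sum (N : ℕ) {h : ℕ → X → ℝ≥0∞} (hh : ∀ n, Measurable (h n)) (x : X) :
    avg κ (fun y => ∑ n ∈ range N, h n y) x = ∑ n ∈ range N, avg κ (h n) x :=
  lintegral_finsetSum _ fun n _ => hh n

theorem avg_pow_zero (hf : Measurable f) : avg (κ ^ 0) f = f :=
  funext (Kernel.lintegral_id' hf)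

instance isMarkovKernel_pow [IsMarkovKernel κ] (n : ℕ) : IsMarkovKernel (κ ^ n) := by
  induction n with
  | zero => exact inferInstanceAs (IsMarkovKernel Kernel.id)
  | succ n ih => exact inferInstanceAs (IsMarkovKernel ((κ ^ n) ∘ₖ κ))

theorem lintegral_avg_of_invariant (hinv : κ.Invariant π) (hf : Measurable f) :
    ∫⁻ x, avg κ f x ∂π = ∫⁻ x, f x ∂π := by
  conv_rhs => rw [← hinv.def]
  exact (Measure.lintegral_bind κ.measurable.aemeasurable hf.aemeasurable).symm

theorem map_swap_compProd_of_isReversible [IsFiniteMeasure π] [IsMarkovKernel κ]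
    (hrev : κ.IsReversible π) : (π ⊗ₘ κ).map Prod.swap = π ⊗ₘ κ := by
  refine Measure.ext_prod fun {A B} hA hB => ?_
  rw [Measure.map_apply measurable_swap (hA.prod hB), Set.preimage_swap_prod,
    Measure.compProd_apply_prod hB hA, Measure.compProd_apply_prod hA hB, hrev hB hA]

theorem lintegral_avg_mul_comm [IsFiniteMeasure π] [IsMarkovKernel κ] (hrev : κ.IsReversible π)
    (hf : Measurable f) (hg : Measurable g) :
    ∫⁻ x, avg κ f x * g x ∂π = ∫⁻ x, f x * avg κ g x ∂π := by
  calc ∫⁻ x, avg κ f x * g x ∂π = ∫⁻ z, f z.2 * g z.1 ∂(π ⊗ₘ κ) := by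
        rw [Measure.lintegral_compProd (by fun_prop)]
        exact lintegral_congr fun x => (lintegral_mul_const _ hf).symm
    _ = ∫⁻ z, f z.1 * g z.2 ∂(π ⊗ₘ κ) := by
        conv_lhs => rw [← map_swap_compProd_of_isReversible hrev]
        exact lintegral_map (by fun_prop) measurable_swap
    _ = ∫⁻ x, f x * avg κ g x ∂π := by
        rw [Measure.lintegral_compProd (by fun_prop)]
        exact lintegral_congr fun x => lintegral_const_mul (f x) hg

theorem lintegral_avg_pow_mul_comm [IsFiniteMeasure π] [IsMarkovKernel κ]
    (hrev : κ.IsReversible π) (n : ℕ) (hf : Measurable f) (hg : Measurable g) :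
    ∫⁻ x, avg (κ ^ n) f x * g x ∂π = ∫⁻ x, f x * avg (κ ^ n) g x ∂π := by
  induction n generalizing g with
  | zero => rw [avg_pow_zero hf, avg_pow_zero hg]
  | succ n ih =>
    calc ∫⁻ x, avg (κ ^ (n + 1)) f x * g x ∂π = ∫⁻ x, avg κ (avg (κ ^ n) f) x * g x ∂π := by
          rw [Kernel.pow_add, pow_one, avg_comp hf]
      _ = ∫⁻ x, f x * avg (κ ^ n) (avg κ g) x ∂π := by
          rw [lintegral_avg_mul_comm hrev (measurable_avg hf) hg, ih (measurable_avg hg)]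
      _ = ∫⁻ x, f x * avg (κ ^ (n + 1)) g x ∂π := by
          rw [add_comm, Kernel.pow_add, pow_one, avg_comp hg]

/-- The law of `(Y, S + Z(Y))` when `(X, S)` has law `ν` and `Y` is a step of the chain with
transition kernel `κ` from `X`. -/
def stepMeasure (κ : Kernel X X) (Z : X → ℝ≥0∞) (ν : Measure (X × ℝ≥0∞)) : Measure (X × ℝ≥0∞) :=
  (ν ⊗ₘ κ.comap Prod.fst measurable_fst).map fun w => (w.2, w.1.2 + Z w.2)

section Step

variable {Z : X → ℝ≥0∞} {ν : Measure (X × ℝ≥0∞)}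

instance : SFinite (stepMeasure κ Z ν) := by
  unfold stepMeasure; infer_instance

theorem lintegral_stepMeasure [SFinite ν] [IsSFiniteKernel κ] (hZ : Measurable Z)
    {F : X × ℝ≥0∞ → ℝ≥0∞} (hF : Measurable F) :
    ∫⁻ z, F z ∂(stepMeasure κ Z ν) = ∫⁻ z, ∫⁻ y, F (y, z.2 + Z y) ∂κ z.1 ∂ν := by
  rw [stepMeasure, lintegral_map hF (by fun_prop), Measure.lintegral_compProd (by fun_prop)]
  rfl

theorem ae_stepMeasure_snd_le (hZ : Measurable Z) {a c : ℝ≥0∞}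
    (ha : ∀ᵐ z ∂ν, z.2 ≤ a) (hc : ∀ x, Z x ≤ c) : ∀ᵐ z ∂(stepMeasure κ Z ν), z.2 ≤ a + c := by
  have hstep : Measurable fun w : (X × ℝ≥0∞) × X => (w.2, w.1.2 + Z w.2) := by fun_prop
  rw [stepMeasure, ae_map_iff hstep.aemeasurable (measurableSet_le measurable_snd measurable_const)]
  refine Measure.ae_compProd_of_ae_ae (measurableSet_le hstep.snd measurable_const) ?_
  filter_upwards [ha] with z hz
  exact .of_forall fun y => add_le_add hz (hc y)

end Step

/-- The joint law of the end point `X₀` and of `∑ n < N, (κ ^ n h n)(X n)` for the stationary chain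
`…, X 2, X 1, X 0` run in the direction of decreasing index. If `κ` is reversible, then
`(κ ^ n h n)(X n)` is the conditional expectation of `h n (X 0)` given `X n, X (n + 1), …`. -/
def chainLaw (κ : Kernel X X) (π : Measure X) : ℕ → (ℕ → X → ℝ≥0∞) → Measure (X × ℝ≥0∞)
  | 0, _ => π.map fun x => (x, 0)
  | N + 1, h => stepMeasure κ (h 0) (chainLaw κ π N fun n => avg κ (h (n + 1)))

section Chain

variable {h : ℕ → X → ℝ≥0∞} {φ : X → ℝ≥0∞}

instance [SFinite π] (N : ℕ) : SFinite (chainLaw κ π N h) := by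
  cases N <;> unfold chainLaw <;> infer_instance

theorem lintegral_chainLaw_fst [SFinite π] [IsSFiniteKernel κ] (hinv : κ.Invariant π) (N : ℕ)
    (hh : ∀ n, Measurable (h n)) (hφ : Measurable φ) :
    ∫⁻ z, φ z.1 ∂(chainLaw κ π N h) = ∫⁻ x, φ x ∂π := by
  induction N generalizing h φ with
  | zero => exact lintegral_map (by fun_prop) (by fun_prop)
  | succ N ih =>
    rw [chainLaw, lintegral_stepMeasure (hh 0) (by fun_prop)]
    exact (ih (fun n => measurable_avg (hh _)) (measurable_avg hφ)).trans
      (lintegral_avg_of_invariant hinv hφ)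

theorem avg_sum_avg_pow_add (N : ℕ) (hh : ∀ n, Measurable (h n)) (x : X) :
    avg κ (fun y => ∑ n ∈ range N, avg (κ ^ (2 * n)) (avg κ (h (n + 1))) y) x + h 0 x =
      ∑ n ∈ range (N + 1), avg (κ ^ (2 * n)) (h n) x := by
  rw [avg_sum N fun n => measurable_avg (measurable_avg (hh _)), sum_range_succ']
  congr 1
  · refine sum_congr rfl fun n _ => ?_
    rw [← avg_comp (hh _), ← avg_comp (hh _)]
    exact congrArg (avg · _ x) (show κ * κ ^ (2 * n) * κ = κ ^ (2 * (n + 1)) by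
      rw [← pow_succ', ← pow_succ]; rfl)
  · rw [mul_zero, avg_pow_zero (hh 0)]

theorem lintegral_chainLaw_snd_mul [IsFiniteMeasure π] [IsMarkovKernel κ]
    (hrev : κ.IsReversible π) (N : ℕ) (hh : ∀ n, Measurable (h n)) (hφ : Measurable φ) :
    ∫⁻ z, z.2 * φ z.1 ∂(chainLaw κ π N h) =
      ∫⁻ x, (∑ n ∈ range N, avg (κ ^ (2 * n)) (h n) x) * φ x ∂π := by
  induction N generalizing h φ with
  | zero =>
    rw [chainLaw, lintegral_map (by fun_prop) (by fun_prop)]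
    simp
  | succ N ih =>
    set h' : ℕ → X → ℝ≥0∞ := fun n => avg κ (h (n + 1))
    have hh' (n : ℕ) : Measurable (h' n) := measurable_avg (hh _)
    set R : X → ℝ≥0∞ := fun x => ∑ n ∈ range N, avg (κ ^ (2 * n)) (h' n) x
    have hR : Measurable R := Finset.measurable_sum _ fun n _ => measurable_avg (hh' n)
    have h0φ : Measurable fun y => h 0 y * φ y := (hh 0).mul hφ
    have hinner (z : X × ℝ≥0∞) : ∫⁻ y, (z.2 + h 0 y) * φ y ∂κ z.1 =
        z.2 * avg κ φ z.1 + avg κ (fun y => h 0 y * φ y) z.1 := by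
      simp only [add_mul]
      rw [lintegral_add_left (hφ.const_mul _), lintegral_const_mul _ hφ]; rfl
    calc ∫⁻ z, z.2 * φ z.1 ∂(chainLaw κ π (N + 1) h)
        = ∫⁻ z, (z.2 * avg κ φ z.1 + avg κ (fun y => h 0 y * φ y) z.1) ∂(chainLaw κ π N h') := by
          rw [chainLaw, lintegral_stepMeasure (hh 0) (by fun_prop)]
          exact lintegral_congr hinner
      _ = ∫⁻ x, R x * avg κ φ x ∂π + ∫⁻ x, h 0 x * φ x ∂π := by
          rw [lintegral_add_left (by fun_prop), ih hh' (measurable_avg hφ),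
            lintegral_chainLaw_fst hrev.invariant N hh' (measurable_avg h0φ),
            lintegral_avg_of_invariant hrev.invariant h0φ]
      _ = ∫⁻ x, (avg κ R x + h 0 x) * φ x ∂π := by
          simp only [add_mul]
          rw [← lintegral_avg_mul_comm hrev hR hφ, lintegral_add_left (by fun_prop)]
      _ = ∫⁻ x, (∑ n ∈ range (N + 1), avg (κ ^ (2 * n)) (h n) x) * φ x ∂π :=
          lintegral_congr fun x => by rw [avg_sum_avg_pow_add N hh]

theorem lintegral_add_rpow_le {q : ℝ} (hq : 1 ≤ q) (a : ℝ≥0∞) [IsMarkovKernel κ]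
    (hf : Measurable f) (x : X) :
    ∫⁻ y, (a + f y) ^ q ∂κ x ≤
      a ^ q + ENNReal.ofReal q * ∫⁻ y, (a + f y) ^ (q - 1) * f y ∂κ x := by
  refine (lintegral_mono fun y => ennreal_add_rpow_le_rpow_add_mul hq a (f y)).trans_eq ?_
  rw [lintegral_add_left measurable_const, lintegral_const_mul _ (by fun_prop)]
  simp

theorem lintegral_chainLaw_snd_rpow_le [SFinite π] [IsMarkovKernel κ] {q : ℝ} (hq : 1 ≤ q) (N : ℕ)
    (hh : ∀ n, Measurable (h n)) :
    ∫⁻ z, z.2 ^ q ∂(chainLaw κ π N h) ≤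
      ENNReal.ofReal q * ∫⁻ z, z.2 ^ (q - 1) * ∑ n ∈ range N, h n z.1 ∂(chainLaw κ π N h) := by
  induction N generalizing h with
  | zero =>
    rw [chainLaw, lintegral_map (by fun_prop) (by fun_prop)]
    simp [show 0 < q by linarith]
  | succ N ih =>
    have h0 := hh 0
    have hh' (n : ℕ) : Measurable (avg κ (h (n + 1))) := measurable_avg (hh _)
    rw [chainLaw]
    set ν : Measure (X × ℝ≥0∞) := chainLaw κ π N fun n => avg κ (h (n + 1))
    rw [lintegral_stepMeasure h0 (by fun_prop), lintegral_stepMeasure h0 (by fun_prop)]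
    have hstep : Measurable fun z : X × ℝ≥0∞ =>
        ∫⁻ y, (z.2 + h 0 y) ^ (q - 1) * h 0 y ∂κ z.1 :=
      Measurable.lintegral_kernel_prod_right (κ := κ.comap Prod.fst measurable_fst)
        (f := fun w : X × ℝ≥0∞ => fun y => (w.2 + h 0 y) ^ (q - 1) * h 0 y) (by fun_prop)
    calc ∫⁻ z, ∫⁻ y, (z.2 + h 0 y) ^ q ∂κ z.1 ∂ν
        ≤ ∫⁻ z, z.2 ^ q ∂ν +
            ENNReal.ofReal q * ∫⁻ z, ∫⁻ y, (z.2 + h 0 y) ^ (q - 1) * h 0 y ∂κ z.1 ∂ν := by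
          rw [← lintegral_const_mul _ hstep, ← lintegral_add_left (by fun_prop)]
          exact lintegral_mono fun z => lintegral_add_rpow_le hq z.2 h0 z.1
      _ ≤ ENNReal.ofReal q * ∫⁻ z, z.2 ^ (q - 1) * ∑ n ∈ range N, avg κ (h (n + 1)) z.1 ∂ν +
            ENNReal.ofReal q * ∫⁻ z, ∫⁻ y, (z.2 + h 0 y) ^ (q - 1) * h 0 y ∂κ z.1 ∂ν := by
          gcongr; exact ih hh'
      _ = ENNReal.ofReal q * ∫⁻ z, ∫⁻ y, (z.2 ^ (q - 1) * ∑ n ∈ range N, h (n + 1) y +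
            (z.2 + h 0 y) ^ (q - 1) * h 0 y) ∂κ z.1 ∂ν := by
          rw [← mul_add, ← lintegral_add_left (by fun_prop)]
          congr! with z
          rw [lintegral_add_left (by fun_prop), lintegral_const_mul _ (by fun_prop),
            ← avg_sum N fun n => hh (n + 1)]
          rfl
      _ ≤ _ := by
          gcongr with z y
          rw [sum_range_succ' _ N, mul_add]
          gcongr
          exact le_self_add

theorem ae_chainLaw_snd_le [IsMarkovKernel κ] (N : ℕ) (hh : ∀ n, Measurable (h n))
    {c : ℝ≥0∞} (hc : ∀ n x, h n x ≤ c) : ∀ᵐ z ∂(chainLaw κ π N h), z.2 ≤ N * c := by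
  induction N generalizing h with
  | zero =>
    rw [chainLaw, ae_map_iff (by fun_prop) (measurableSet_le measurable_snd measurable_const)]
    simp
  | succ N ih =>
    rw [Nat.cast_succ, add_mul, one_mul]
    exact ae_stepMeasure_snd_le (hh 0)
      (ih (fun n => measurable_avg (hh _)) fun n => avg_le_const (hc _)) (hc 0)

end Chain

section Duality

variable {p q : ℝ}

theorem rpow_le_of_le_mul_rpow (hpq : p.HolderConjugate q) {A c : ℝ≥0∞} (hA : A ≠ ∞)
    (h : A ≤ c * A ^ (1 / p)) : A ^ (1 / q) ≤ c := by
  rcases eq_or_ne A 0 with rfl | h0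
  · simp [hpq.symm.pos]
  have hsplit : A ^ (1 / q) * A ^ (1 / p) = A := by
    rw [← ENNReal.rpow_add _ _ h0 hA, one_div, one_div, add_comm, hpq.inv_add_inv_eq_one,
      ENNReal.rpow_one]
  have hp0 : A ^ (1 / p) ≠ 0 := by simp [h0, hA]
  have hpt : A ^ (1 / p) ≠ ∞ := ENNReal.rpow_ne_top_of_nonneg (by simpa using hpq.nonneg) hA
  rwa [← ENNReal.mul_le_mul_iff_left hp0 hpt, hsplit]

variable {h : ℕ → X → ℝ≥0∞} {φ : X → ℝ≥0∞} [IsFiniteMeasure π] [IsMarkovKernel κ]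

theorem lintegral_chainLaw_snd_rpow_ne_top (hrev : κ.IsReversible π) (hq : 0 ≤ q) (N : ℕ)
    (hh : ∀ n, Measurable (h n)) {c : ℝ≥0∞} (hc : c ≠ ∞) (hhc : ∀ n x, h n x ≤ c) :
    ∫⁻ z, z.2 ^ q ∂(chainLaw κ π N h) ≠ ∞ := by
  have hmass : chainLaw κ π N h Set.univ = π Set.univ := by
    simpa using lintegral_chainLaw_fst (φ := fun _ => 1) hrev.invariant N hh measurable_const
  have hbound : ∫⁻ z, z.2 ^ q ∂(chainLaw κ π N h) ≤ (N * c) ^ q * π Set.univ := by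
    rw [← hmass, ← lintegral_const]
    refine lintegral_mono_ae ?_
    filter_upwards [ae_chainLaw_snd_le N hh hhc] with z hz using ENNReal.rpow_le_rpow hz hq
  refine ne_top_of_le_ne_top (ENNReal.mul_ne_top ?_ (measure_ne_top π _)) hbound
  exact ENNReal.rpow_ne_top_of_nonneg hq (ENNReal.mul_ne_top (ENNReal.natCast_ne_top N) hc)

theorem lintegral_chainLaw_snd_rpow_rpow_le (hrev : κ.IsReversible π) (hpq : p.HolderConjugate q)
    (N : ℕ) (hh : ∀ n, Measurable (h n)) {c : ℝ≥0∞} (hc : c ≠ ∞) (hhc : ∀ n x, h n x ≤ c) :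
    (∫⁻ z, z.2 ^ q ∂(chainLaw κ π N h)) ^ (1 / q) ≤
      ENNReal.ofReal q * (∫⁻ x, (∑ n ∈ range N, h n x) ^ q ∂π) ^ (1 / q) := by
  refine rpow_le_of_le_mul_rpow hpq
    (lintegral_chainLaw_snd_rpow_ne_top hrev hpq.symm.nonneg N hh hc hhc)
    ((lintegral_chainLaw_snd_rpow_le hpq.symm.lt.le N hh).trans ?_)
  rw [mul_assoc]
  gcongr
  refine (ENNReal.lintegral_mul_le_Lp_mul_Lq _ hpq (by fun_prop) (by fun_prop)).trans_eq ?_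
  have hpow (a : ℝ≥0∞) : (a ^ (q - 1)) ^ p = a ^ q := by
    rw [← ENNReal.rpow_mul, hpq.symm.sub_one_mul_conj]
  simp only [hpow]
  rw [mul_comm, lintegral_chainLaw_fst (φ := fun x => (∑ n ∈ range N, h n x) ^ q)
    hrev.invariant N hh (by fun_prop)]

theorem lintegral_sum_avg_mul_le (hrev : κ.IsReversible π) (hpq : p.HolderConjugate q) (N : ℕ)
    (hh : ∀ n, Measurable (h n)) {c : ℝ≥0∞} (hc : c ≠ ∞) (hhc : ∀ n x, h n x ≤ c)
    (hφ : Measurable φ) :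
    ∫⁻ x, (∑ n ∈ range N, avg (κ ^ (2 * n)) (h n) x) * φ x ∂π ≤
      ENNReal.ofReal q * (∫⁻ x, (∑ n ∈ range N, h n x) ^ q ∂π) ^ (1 / q) *
        (∫⁻ x, φ x ^ p ∂π) ^ (1 / p) := by
  rw [← lintegral_chainLaw_snd_mul hrev N hh hφ]
  refine (ENNReal.lintegral_mul_le_Lp_mul_Lq _ hpq.symm (by fun_prop) (by fun_prop)).trans ?_
  rw [lintegral_chainLaw_fst (φ := fun x => φ x ^ p) hrev.invariant N hh (by fun_prop)]
  gcongr
  exact lintegral_chainLaw_snd_rpow_rpow_le hrev hpq N hh hc hhc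

end Duality

theorem measurable_range_sup (N : ℕ) {u : ℕ → X → ℝ≥0∞} (hu : ∀ n, Measurable (u n)) :
    Measurable fun x => (range N).sup fun n => u n x := by
  simp only [Finset.sup_eq_iSup]
  fun_prop

theorem exists_sum_mul_eq_mul_sup (N : ℕ) {u : ℕ → X → ℝ≥0∞} (hu : ∀ n, Measurable (u n))
    (hg : Measurable g) :
    ∃ h : ℕ → X → ℝ≥0∞, (∀ n, Measurable (h n)) ∧ (∀ n x, h n x ≤ g x) ∧
      (∀ x, ∑ n ∈ range N, h n x ≤ g x) ∧
      ∀ x, ∑ n ∈ range N, h n x * u n x = g x * (range N).sup fun n => u n x := by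
  set E : ℕ → Set X := fun n => {x | u n x = (range N).sup fun k => u k x}
  have hE (n : ℕ) : MeasurableSet (E n) := measurableSet_eq_fun (hu n) (measurable_range_sup N hu)
  have hsum (x : X) : ∑ n ∈ range N, (disjointed E n).indicator g x =
      (⋃ n ∈ range N, disjointed E n).indicator g x :=
    (congrFun (indicator_biUnion _ _ ((disjoint_disjointed E).set_pairwise _)) x).symm
  refine ⟨fun n => (disjointed E n).indicator g, fun n => hg.indicator (.disjointed hE n),
    fun n => Set.indicator_le_self _ g, fun x => (hsum x).trans_le (Set.indicator_le_self _ g x),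
    fun x => ?_⟩
  have hmul (n : ℕ) : (disjointed E n).indicator g x * u n x =
      (disjointed E n).indicator g x * (range N).sup fun k => u k x := by
    by_cases hx : x ∈ disjointed E n
    · rw [show u n x = _ from disjointed_subset E n hx]
    · simp [hx]
  rw [sum_congr rfl fun n _ => hmul n, ← sum_mul, hsum]
  rcases N with - | N
  · simp
  obtain ⟨n, hn, hxn⟩ := exists_mem_eq_sup (range (N + 1)) nonempty_range_add_one fun n => u n x
  rw [biUnion_range_succ_disjointed, partialSups_eq_biUnion_range,
    Set.indicator_of_mem (Set.mem_iUnion₂_of_mem hn hxn.symm)]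

theorem iSup_avg_pow_eq_iSup_truncated (hf : Measurable f) (x : X) :
    ⨆ n, avg (κ ^ (2 * n)) f x =
      ⨆ m : ℕ, (range m).sup fun n => avg (κ ^ (2 * n)) (fun y => min (f y) m) x := by
  have hmono : Monotone fun (m : ℕ) y => min (f y) m :=
    fun i j hij y => min_le_min le_rfl (by exact_mod_cast hij)
  have hsup : f = fun y => ⨆ m : ℕ, min (f y) m := by
    ext y
    exact (by rw [← inf_iSup_eq, ENNReal.iSup_natCast, inf_top_eq] : ⨆ m : ℕ, f y ⊓ m = f y).symm
  have havg (n : ℕ) : avg (κ ^ (2 * n)) f x =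
      ⨆ m : ℕ, avg (κ ^ (2 * n)) (fun y => min (f y) m) x := by
    conv_lhs => rw [hsup]
    exact lintegral_iSup (fun m => hf.min measurable_const) hmono
  refine le_antisymm (iSup_le fun n => ?_) (iSup_le fun m => Finset.sup_le fun n _ =>
    le_iSup_of_le n (avg_mono (fun y => min_le_left _ _) x))
  rw [havg]
  refine iSup_le fun m => le_iSup_of_le (max m (n + 1)) ?_
  exact (avg_mono (hmono (le_max_left m (n + 1))) x).trans
    (Finset.le_sup (f := fun k => avg (κ ^ (2 * k)) (fun y => min (f y) _) x)
      (mem_range.2 (le_max_right m (n + 1))))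

section MaximalInequality

variable {p q : ℝ} [IsFiniteMeasure π] [IsMarkovKernel κ]

theorem lintegral_sup_avg_pow_rpow_le_mul (hrev : κ.IsReversible π) (hpq : p.HolderConjugate q)
    (N : ℕ) (hf : Measurable f) {c : ℝ≥0∞} (hc : c ≠ ∞) (hfc : ∀ x, f x ≤ c) :
    ∫⁻ x, ((range N).sup fun n => avg (κ ^ (2 * n)) f x) ^ p ∂π ≤
      ENNReal.ofReal q * (∫⁻ x, f x ^ p ∂π) ^ (1 / p) *
        (∫⁻ x, ((range N).sup fun n => avg (κ ^ (2 * n)) f x) ^ p ∂π) ^ (1 / q) := by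
  have hu (n : ℕ) : Measurable (avg (κ ^ (2 * n)) f) := measurable_avg hf
  set M : X → ℝ≥0∞ := fun x => (range N).sup fun n => avg (κ ^ (2 * n)) f x
  have hMm : Measurable M := measurable_range_sup N hu
  have hMc (x : X) : M x ≤ c := Finset.sup_le fun n _ => avg_le_const hfc x
  have hp1 : 0 ≤ p - 1 := hpq.sub_one_pos.le
  obtain ⟨h, hh, hle, hsum, hmul⟩ := exists_sum_mul_eq_mul_sup N hu (hMm.pow_const (p - 1))
  calc ∫⁻ x, M x ^ p ∂π = ∫⁻ x, ∑ n ∈ range N, h n x * avg (κ ^ (2 * n)) f x ∂π := by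
        refine lintegral_congr fun x => ?_
        rw [hmul x, show M x ^ (p - 1) * _ = M x ^ (p - 1) * M x ^ (1 : ℝ) by rw [ENNReal.rpow_one],
          ← ENNReal.rpow_add_of_nonneg _ _ hp1 zero_le_one, sub_add_cancel]
    _ = ∫⁻ x, (∑ n ∈ range N, avg (κ ^ (2 * n)) (h n) x) * f x ∂π := by
        simp only [Finset.sum_mul]
        rw [lintegral_finsetSum _ fun n _ => by fun_prop,
          lintegral_finsetSum _ fun n _ => by fun_prop]
        exact sum_congr rfl fun n _ => (lintegral_avg_pow_mul_comm hrev (2 * n) (hh n) hf).symm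
    _ ≤ ENNReal.ofReal q * (∫⁻ x, (∑ n ∈ range N, h n x) ^ q ∂π) ^ (1 / q) *
          (∫⁻ x, f x ^ p ∂π) ^ (1 / p) :=
        lintegral_sum_avg_mul_le hrev hpq N hh (ENNReal.rpow_ne_top_of_nonneg hp1 hc)
          (fun n x => (hle n x).trans (ENNReal.rpow_le_rpow (hMc x) hp1)) hf
    _ ≤ ENNReal.ofReal q * (∫⁻ x, M x ^ p ∂π) ^ (1 / q) * (∫⁻ x, f x ^ p ∂π) ^ (1 / p) := by
        gcongr with x
        · exact one_div_nonneg.2 hpq.symm.nonneg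
        · refine (ENNReal.rpow_le_rpow (hsum x) hpq.symm.nonneg).trans_eq ?_
          rw [← ENNReal.rpow_mul, hpq.sub_one_mul_conj]
    _ = _ := by ring

theorem lintegral_sup_avg_pow_rpow_le (hrev : κ.IsReversible π) (hpq : p.HolderConjugate q)
    (N : ℕ) (hf : Measurable f) {c : ℝ≥0∞} (hc : c ≠ ∞) (hfc : ∀ x, f x ≤ c) :
    ∫⁻ x, ((range N).sup fun n => avg (κ ^ (2 * n)) f x) ^ p ∂π ≤
      ENNReal.ofReal q ^ p * ∫⁻ x, f x ^ p ∂π := by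
  set A := ∫⁻ x, ((range N).sup fun n => avg (κ ^ (2 * n)) f x) ^ p ∂π
  have hfin : A ≠ ∞ := by
    refine ne_top_of_le_ne_top (ENNReal.mul_ne_top ?_ (measure_ne_top π Set.univ))
      ((lintegral_mono fun x => ENNReal.rpow_le_rpow
        (Finset.sup_le fun n _ => avg_le_const hfc x) hpq.nonneg).trans_eq (lintegral_const _))
    exact ENNReal.rpow_ne_top_of_nonneg hpq.nonneg hc
  have hnorm : A ^ (1 / p) ≤ ENNReal.ofReal q * (∫⁻ x, f x ^ p ∂π) ^ (1 / p) :=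
    rpow_le_of_le_mul_rpow hpq.symm hfin (lintegral_sup_avg_pow_rpow_le_mul hrev hpq N hf hc hfc)
  have := ENNReal.rpow_le_rpow hnorm hpq.nonneg
  rwa [← ENNReal.rpow_mul, ENNReal.mul_rpow_of_nonneg _ _ hpq.nonneg, ← ENNReal.rpow_mul,
    one_div_mul_cancel hpq.ne_zero, ENNReal.rpow_one, ENNReal.rpow_one] at this

/-- Rota's maximal inequality. -/
theorem lintegral_iSup_avg_pow_rpow_le (hrev : κ.IsReversible π) (hpq : p.HolderConjugate q)
    (hf : Measurable f) :
    ∫⁻ x, (⨆ n, avg (κ ^ (2 * n)) f x) ^ p ∂π ≤ ENNReal.ofReal q ^ p * ∫⁻ x, f x ^ p ∂π := by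
  have hmono : Monotone fun (m : ℕ) x =>
      ((range m).sup fun n => avg (κ ^ (2 * n)) (fun y => min (f y) m) x) ^ p := by
    intro i j hij x
    refine ENNReal.rpow_le_rpow ((Finset.sup_mono_fun fun n _ => ?_).trans
      (Finset.sup_mono (range_mono hij))) hpq.nonneg
    exact avg_mono (fun y => min_le_min le_rfl (by exact_mod_cast hij)) x
  have hpow (x : X) : (⨆ n, avg (κ ^ (2 * n)) f x) ^ p =
      ⨆ m : ℕ, ((range m).sup fun n => avg (κ ^ (2 * n)) (fun y => min (f y) m) x) ^ p := by
    rw [iSup_avg_pow_eq_iSup_truncated hf]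
    exact (ENNReal.orderIsoRpow p hpq.pos).map_iSup _
  simp only [hpow]
  rw [lintegral_iSup (fun m => (measurable_range_sup m fun n => by fun_prop).pow_const p) hmono]
  refine iSup_le fun m => (lintegral_sup_avg_pow_rpow_le hrev hpq m (by fun_prop)
    (ENNReal.natCast_ne_top m) fun x => min_le_right _ _).trans ?_
  gcongr with x
  · exact hpq.nonneg
  · exact min_le_left _ _

end MaximalInequality

end Rota

section SymmetricSemigroup

variable {X : Type*} [MeasurableSpace X]

/-- A semigroup of Markov kernels `κ t`, `t > 0`, each of them reversible with respect to `π`; the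
values of `κ` at `t ≤ 0` are junk. -/
structure IsSymmetricMarkovSemigroup (κ : ℝ → Kernel X X) (π : Measure X) : Prop where
  isMarkovKernel : ∀ ⦃t⦄, 0 < t → IsMarkovKernel (κ t)
  isReversible : ∀ ⦃t⦄, 0 < t → (κ t).IsReversible π
  comp_eq_add : ∀ ⦃s t⦄, 0 < s → 0 < t → κ s ∘ₖ κ t = κ (s + t)

/-- The maximal function of a semigroup of kernels over the positive dyadic times. -/
def dyadicMaximal (κ : ℝ → Kernel X X) (f : X → ℝ≥0∞) (x : X) : ℝ≥0∞ :=
  ⨆ (j : ℕ) (n : ℕ), avg (κ ((n + 1) / 2 ^ j)) f x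

variable {κ : ℝ → Kernel X X} {π : Measure X} {f : X → ℝ≥0∞}

theorem monotone_iSup_avg_dyadic :
    Monotone fun (j : ℕ) (x : X) => ⨆ n : ℕ, avg (κ ((n + 1) / 2 ^ j)) f x := by
  refine monotone_nat_of_le_succ fun j x => iSup_le fun n => le_iSup_of_le (2 * n + 1) ?_
  rw [show (((2 * n + 1 : ℕ) : ℝ) + 1) / 2 ^ (j + 1) = (n + 1) / 2 ^ j by
    push_cast; rw [pow_succ]; field_simp; ring]

namespace IsSymmetricMarkovSemigroup

theorem pow_eq (hκ : IsSymmetricMarkovSemigroup κ π) {t : ℝ} (ht : 0 < t) (n : ℕ) :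
    κ t ^ (n + 1) = κ ((n + 1) * t) := by
  induction n with
  | zero => simp
  | succ n ih =>
    rw [Kernel.pow_add, ih, pow_one, hκ.comp_eq_add (by positivity) ht]
    congr 1; push_cast; ring

theorem avg_dyadic_eq (hκ : IsSymmetricMarkovSemigroup κ π) (j n : ℕ) :
    avg (κ ((n + 1) / 2 ^ j)) f = avg (κ (1 / 2 ^ (j + 1)) ^ (2 * (n + 1))) f := by
  rw [show 2 * (n + 1) = (2 * n + 1) + 1 by ring, hκ.pow_eq (by positivity)]
  congr 2; push_cast; rw [pow_succ]; field_simp; ring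

theorem lintegral_dyadicMaximal_rpow_le [IsFiniteMeasure π]
    (hκ : IsSymmetricMarkovSemigroup κ π) {p q : ℝ} (hpq : p.HolderConjugate q)
    (hf : Measurable f) :
    ∫⁻ x, dyadicMaximal κ f x ^ p ∂π ≤ ENNReal.ofReal q ^ p * ∫⁻ x, f x ^ p ∂π := by
  have hpow (x : X) : dyadicMaximal κ f x ^ p =
      ⨆ j : ℕ, (⨆ n : ℕ, avg (κ ((n + 1) / 2 ^ j)) f x) ^ p :=
    (ENNReal.orderIsoRpow p hpq.pos).map_iSup _
  simp only [hpow]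
  rw [lintegral_iSup
    (fun j => (Measurable.iSup fun n : ℕ => measurable_avg hf).pow_const p)
    fun i j hij x => ENNReal.rpow_le_rpow (monotone_iSup_avg_dyadic hij x) hpq.nonneg]
  refine iSup_le fun j => ?_
  have hs : (0 : ℝ) < 1 / 2 ^ (j + 1) := by positivity
  have := hκ.isMarkovKernel hs
  refine (lintegral_mono fun x => ENNReal.rpow_le_rpow (iSup_le fun n => ?_) hpq.nonneg).trans
    (lintegral_iSup_avg_pow_rpow_le (hκ.isReversible hs) hpq hf)
  rw [hκ.avg_dyadic_eq]
  exact le_iSup (fun n => avg (κ (1 / 2 ^ (j + 1)) ^ (2 * n)) f x) (n + 1)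

theorem ae_avg_le_essSup (hκ : IsSymmetricMarkovSemigroup κ π) {t : ℝ} (ht : 0 < t) :
    ∀ᵐ x ∂π, avg (κ t) f x ≤ eLpNormEssSup f π := by
  have := hκ.isMarkovKernel ht
  have hbound : ∀ᵐ y ∂(π.bind (κ t)), f y ≤ eLpNormEssSup f π := by
    rw [(hκ.isReversible ht).invariant.def]
    exact ae_le_eLpNormEssSup
  filter_upwards [Measure.ae_ae_of_ae_comp hbound] with x hx
  exact (lintegral_mono_ae hx).trans (by simp)

theorem eLpNorm_dyadicMaximal_le [IsFiniteMeasure π] (hκ : IsSymmetricMarkovSemigroup κ π)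
    {p q : ℝ≥0∞} [hpq : p.HolderConjugate q] (hp : 1 < p) (hf : Measurable f) :
    eLpNorm (dyadicMaximal κ f) p π ≤ q * eLpNorm f p π := by
  rcases eq_or_ne p ∞ with rfl | hpt
  · rw [(ENNReal.HolderConjugate.eq_top_iff_eq_one ∞ q).1 rfl, one_mul, eLpNorm_exponent_top,
      eLpNorm_exponent_top]
    have hae : ∀ᵐ x ∂π, ∀ j n : ℕ, avg (κ ((n + 1) / 2 ^ j)) f x ≤ eLpNormEssSup f π :=
      ae_all_iff.2 fun j => ae_all_iff.2 fun n => hκ.ae_avg_le_essSup (by positivity)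
    exact eLpNormEssSup_le_of_ae_enorm_bound (hae.mono fun x hx => iSup₂_le hx)
  · have hr : p.toReal.HolderConjugate q.toReal := ENNReal.HolderConjugate.toReal
      ((ENNReal.toReal_lt_toReal ENNReal.one_ne_top hpt).2 hp)
    have hq : q ≠ ∞ := ((ENNReal.HolderConjugate.ne_top_iff_ne_one q p).2 hp.ne')
    have hp0 : p ≠ 0 := (zero_lt_one.trans hp).ne'
    rw [eLpNorm_eq_lintegral_rpow_enorm_toReal hp0 hpt, eLpNorm_eq_lintegral_rpow_enorm_toReal hp0
      hpt, one_div, ENNReal.rpow_inv_le_iff hr.pos, ENNReal.mul_rpow_of_nonneg _ _ hr.nonneg,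
      ENNReal.rpow_inv_rpow hr.ne_zero]
    simpa only [enorm_eq_self, ENNReal.ofReal_toReal hq] using
      hκ.lintegral_dyadicMaximal_rpow_le hr hf

end IsSymmetricMarkovSemigroup

end SymmetricSemigroup

section Density

variable {X : Type*} [MeasurableSpace X] {π : Measure X} [SFinite π] {k l : X → X → ℝ≥0∞}

/-- The kernel with density `k x y` with respect to `π(dy)`; it is `0` unless `k` is jointly
measurable. -/
def densityKernel (π : Measure X) [SFinite π] (k : X → X → ℝ≥0∞) : Kernel X X :=
  Kernel.withDensity (Kernel.const X π) k

theorem avg_densityKernel (hk : Measurable (Function.uncurry k)) {f : X → ℝ≥0∞}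
    (hf : Measurable f) (x : X) : avg (densityKernel π k) f x = ∫⁻ y, k x y * f y ∂π := by
  rw [avg, densityKernel, Kernel.lintegral_withDensity _ hk _ hf, Kernel.const_apply]

theorem densityKernel_apply' (hk : Measurable (Function.uncurry k)) (x : X) (s : Set X) :
    densityKernel π k x s = ∫⁻ y in s, k x y ∂π := by
  rw [densityKernel, Kernel.withDensity_apply' _ hk, Kernel.const_apply]

theorem isReversible_densityKernel (hk : Measurable (Function.uncurry k))
    (hsymm : ∀ x y, k x y = k y x) : (densityKernel π k).IsReversible π := by
  intro A B _ _
  simp only [densityKernel_apply' hk]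
  rw [lintegral_lintegral_swap hk.aemeasurable]
  simp only [hsymm]

theorem densityKernel_comp (hk : Measurable (Function.uncurry k))
    (hl : Measurable (Function.uncurry l)) :
    densityKernel π l ∘ₖ densityKernel π k =
      densityKernel π fun x z => ∫⁻ y, k x y * l y z ∂π := by
  have hkl : Measurable fun p : (X × X) × X => k p.1.1 p.2 * l p.2 p.1.2 :=
    (hk.comp (by fun_prop : Measurable fun p : (X × X) × X => (p.1.1, p.2))).mul
      (hl.comp (by fun_prop : Measurable fun p : (X × X) × X => (p.2, p.1.2)))
  ext x s hs
  rw [Kernel.comp_apply' _ _ _ hs, densityKernel_apply' hkl.lintegral_prod_right',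
    ← avg, avg_densityKernel hk (Kernel.measurable_coe _ hs)]
  simp only [densityKernel_apply' hl, ← lintegral_const_mul _ hl.of_uncurry_left]
  rw [lintegral_lintegral_swap]
  exact ((hk.of_uncurry_left.comp measurable_fst).mul hl).aemeasurable

end Density

/-! ### Power series and Laguerre polynomials -/

section Series

variable {α : ℝ}

theorem Gamma_natCast_add_add_one_pos (hα : -1 < α) (n : ℕ) : 0 < Real.Gamma (n + α + 1) :=
  Real.Gamma_pos_of_pos (by linarith [Nat.cast_nonneg (α := ℝ) n])

theorem Gamma_natCast_succ_add_add_one (hα : -1 < α) (n : ℕ) :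
    Real.Gamma ((n + 1 : ℕ) + α + 1) = (n + α + 1) * Real.Gamma (n + α + 1) := by
  rw [← Real.Gamma_add_one (by linarith [Nat.cast_nonneg (α := ℝ) n])]
  push_cast
  ring_nf

theorem ascPochhammer_eval_mul_Gamma {b : ℝ} (hb : 0 < b) (n : ℕ) :
    (ascPochhammer ℝ n).eval b * Real.Gamma b = Real.Gamma (n + b) := by
  induction n with
  | zero => simp
  | succ n ih =>
    rw [Nat.cast_succ, add_right_comm, Real.Gamma_add_one (by positivity), ← ih,
      ascPochhammer_succ_eval]
    ring

theorem hasSum_binomial {b r : ℝ} (hb : 0 < b) (hr : |r| < 1) :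
    HasSum (fun m : ℕ => Real.Gamma (m + b) / (Real.Gamma b * m.factorial) * r ^ m)
      ((1 - r) ^ (-b)) := by
  have hball := (Real.one_div_one_sub_rpow_hasFPowerSeriesOnBall_zero b).hasSum (y := r)
    (by simpa [enorm_eq_nnnorm] using! hr)
  have hr1 : 0 ≤ 1 - r := by linarith [(abs_lt.1 hr).2]
  rw [zero_add, one_div, ← Real.rpow_neg hr1] at hball
  convert! hball using 1
  ext m
  have hΓ : Real.Gamma b ≠ 0 := (Real.Gamma_pos_of_pos hb).ne'
  have hchoose : Ring.choose (b + m - 1) m * m.factorial = (ascPochhammer ℝ m).eval b := by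
    have := Ring.factorial_nsmul_multichoose_eq_ascPochhammer b m
    rw [Polynomial.ascPochhammer_smeval_eq_eval] at this
    rw [← this, nsmul_eq_mul, mul_comm, Ring.choose]
    congr 2
    ring
  rw [← ascPochhammer_eval_mul_Gamma hb, ← hchoose]
  simp
  field_simp

theorem hasSum_antidiagonal {F : ℕ × ℕ → ℝ} {s : ℝ} (hF : HasSum F s) :
    HasSum (fun n => ∑ kl ∈ antidiagonal n, F kl) s := by
  refine (HasAntidiagonal.sigmaAntidiagonalEquivProd.hasSum_iff.2 hF).sigma fun n => ?_
  rw [← Finset.sum_coe_sort (antidiagonal n) F]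
  exact hasSum_fintype fun kl : antidiagonal n => F kl

theorem summable_of_summable_antidiagonal {F : ℕ × ℕ → ℝ}
    (h : Summable fun n => ∑ kl ∈ antidiagonal n, |F kl|) : Summable F := by
  rw [← summable_abs_iff, ← HasAntidiagonal.sigmaAntidiagonalEquivProd.summable_iff]
  refine (summable_sigma_of_nonneg fun x => abs_nonneg _).2
    ⟨fun n => (hasSum_fintype _).summable, h.congr fun n => ?_⟩
  rw [tsum_fintype]
  exact (Finset.sum_coe_sort (antidiagonal n) fun kl => |F kl|).symm

theorem sum_antidiagonal_choose_mul_pow (c : ℕ → ℝ) (r w : ℝ) (n : ℕ) :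
    ∑ km ∈ antidiagonal n, w ^ km.1 * ((km.2 + km.1).choose km.1 * c (km.2 + km.1) * r ^ km.2) =
      c n * (w + r) ^ n := by
  rw [(Commute.all w r).add_pow', Finset.mul_sum]
  refine Finset.sum_congr rfl fun km hkm => ?_
  rw [add_comm km.2, mem_antidiagonal.1 hkm, nsmul_eq_mul]
  ring

theorem summable_choose_mul_pow {c : ℕ → ℝ} (hc : ∀ r, |r| < 1 → Summable fun n => c n * r ^ n)
    {r w : ℝ} (hrw : |w| + |r| < 1) : Summable fun km : ℕ × ℕ =>
      w ^ km.1 * ((km.2 + km.1).choose km.1 * c (km.2 + km.1) * r ^ km.2) := by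
  refine summable_of_summable_antidiagonal ?_
  have habs := (hc (|w| + |r|) (by rwa [abs_of_nonneg (by positivity)])).abs
  simpa only [abs_mul, abs_pow, abs_abs, Nat.abs_cast, abs_of_nonneg (by positivity :
    0 ≤ |w| + |r|), sum_antidiagonal_choose_mul_pow fun n => |c n|] using habs

theorem coeff_eq_of_eventually_hasSum {c d : ℕ → ℝ} {f : ℝ → ℝ}
    (hc : ∀ᶠ z in 𝓝 0, HasSum (fun n => z ^ n * c n) (f z))
    (hd : ∀ᶠ z in 𝓝 0, HasSum (fun n => z ^ n * d n) (f z)) : c = d := by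
  have hasFPowerSeriesAt : ∀ {e : ℕ → ℝ}, (∀ᶠ z in 𝓝 0, HasSum (fun n => z ^ n * e n) (f z)) →
      HasFPowerSeriesAt f (FormalMultilinearSeries.ofScalars ℝ e) 0 := fun he =>
    hasFPowerSeriesAt_iff.2 <| by
      simpa only [FormalMultilinearSeries.coeff_ofScalars, smul_eq_mul, zero_add] using he
  exact FormalMultilinearSeries.ofScalars_series_injective ℝ ℝ
    ((hasFPowerSeriesAt hc).eq_formalMultilinearSeries (hasFPowerSeriesAt hd))

theorem hasSum_choose_mul_pow {c d : ℕ → ℝ} {f : ℝ → ℝ} {r : ℝ}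
    (hc : ∀ s, |s| < 1 → HasSum (fun n => c n * s ^ n) (f s)) (hr : |r| < 1)
    (hd : ∀ᶠ w in 𝓝 0, HasSum (fun k => w ^ k * d k) (f (w + r))) (k : ℕ) :
    HasSum (fun m => (m + k).choose k * c (m + k) * r ^ m) (d k) := by
  have hsummable {w : ℝ} (hw : |w| < 1 - |r|) :=
    summable_choose_mul_pow (fun s hs => (hc s hs).summable) (show |w| + |r| < 1 by linarith)
  have hrow (k : ℕ) : Summable fun m => (m + k).choose k * c (m + k) * r ^ m := by
    obtain ⟨w, hw0, hw⟩ := exists_between (sub_pos.2 hr)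
    have := (hsummable (by rwa [abs_of_pos hw0])).prod_factor k
    exact (summable_mul_left_iff (pow_ne_zero k hw0.ne')).1 this
  have hnhds : ∀ᶠ w in 𝓝 (0 : ℝ), |w| < 1 - |r| :=
    continuous_abs.continuousAt.eventually_lt continuousAt_const (by simpa using hr)
  have hcoeff : (fun k => ∑' m, (m + k).choose k * c (m + k) * r ^ m) = d := by
    refine coeff_eq_of_eventually_hasSum (f := fun w => f (w + r)) ?_ hd
    filter_upwards [hnhds] with w hw
    have hsum := hc (w + r) ((abs_add_le w r).trans_lt (by linarith))
    simp only [← sum_antidiagonal_choose_mul_pow] at hsum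
    have hrows := (hsummable hw).hasSum.prod_fiberwise fun k => (hrow k).hasSum.mul_left (w ^ k)
    rwa [(hasSum_antidiagonal (hsummable hw).hasSum).unique hsum] at hrows
  exact hcoeff ▸ (hrow k).hasSum

theorem laguerre_eq_sum_antidiagonal (α : ℝ) (n : ℕ) (x : ℝ) :
    laguerre α n x = Real.Gamma (n + α + 1) * ∑ kl ∈ antidiagonal n,
      (-x) ^ kl.1 / (kl.1.factorial * Real.Gamma (kl.1 + α + 1)) * (1 / kl.2.factorial) := by
  rw [laguerre, Finset.Nat.sum_antidiagonal_eq_sum_range_succ fun k l : ℕ =>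
    (-x) ^ k / (k.factorial * Real.Gamma (k + α + 1)) * (1 / (l.factorial : ℝ)), Finset.mul_sum]
  refine Finset.sum_congr rfl fun k _ => ?_
  rw [neg_pow x]
  simp only [div_eq_mul_inv, mul_inv]
  ring

theorem abs_laguerre_le (hα : -1 < α) (n : ℕ) (x : ℝ) :
    |laguerre α n x| ≤ laguerre α n (-|x|) := by
  have hn := Gamma_natCast_add_add_one_pos hα n
  rw [laguerre_eq_sum_antidiagonal, laguerre_eq_sum_antidiagonal, abs_mul, abs_of_pos hn]
  gcongr
  refine (Finset.abs_sum_le_sum_abs _ _).trans (Finset.sum_le_sum fun kl _ => ?_)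
  have hk := Gamma_natCast_add_add_one_pos hα kl.1
  rw [abs_mul, abs_div, abs_pow, abs_neg, neg_neg, abs_of_pos (a := _ * _) (by positivity),
    abs_of_pos (a := 1 / _) (by positivity)]

theorem hasSum_exp (z : ℝ) : HasSum (fun k : ℕ => z ^ k / k.factorial) (Real.exp z) := by
  simpa only [Real.exp_eq_exp_ℝ] using NormedSpace.expSeries_div_hasSum_exp z

/-- The double series in `k` and `m` which has the generating function of the Laguerre polynomials
as its sum: summing it over `k + m = n` gives `L_n(x) r ^ n`. -/
def laguerreGenArray (α x r : ℝ) (km : ℕ × ℕ) : ℝ :=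
  (-x * r) ^ km.1 / km.1.factorial * (Real.Gamma (km.2 + (km.1 + α + 1)) /
    (Real.Gamma (km.1 + α + 1) * km.2.factorial) * r ^ km.2)

theorem sum_antidiagonal_laguerreGenArray (α x r : ℝ) (n : ℕ) :
    ∑ km ∈ antidiagonal n, laguerreGenArray α x r km = laguerre α n x * r ^ n := by
  rw [laguerre_eq_sum_antidiagonal, mul_assoc, Finset.sum_mul, Finset.mul_sum]
  refine Finset.sum_congr rfl fun km hkm => ?_
  rw [← mem_antidiagonal.1 hkm, laguerreGenArray, pow_add, mul_pow]
  push_cast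
  rw [show (km.2 : ℝ) + (km.1 + α + 1) = km.1 + km.2 + α + 1 by ring]
  simp only [div_eq_mul_inv, mul_inv]
  ring

theorem hasSum_laguerreGenArray_row (hα : -1 < α) {r : ℝ} (hr : |r| < 1) (x : ℝ) (k : ℕ) :
    HasSum (fun m => laguerreGenArray α x r (k, m))
      ((1 - r) ^ (-(α + 1)) * ((-x * r / (1 - r)) ^ k / k.factorial)) := by
  have h1r : 0 < 1 - r := by linarith [(abs_lt.1 hr).2]
  convert! (hasSum_binomial (b := k + α + 1) (by linarith [Nat.cast_nonneg (α := ℝ) k])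
    hr).mul_left ((-x * r) ^ k / (k.factorial : ℝ)) using 1
  rw [add_assoc, neg_add (k : ℝ), Real.rpow_add h1r, Real.rpow_neg h1r.le (k : ℝ),
    Real.rpow_natCast, div_pow]
  field_simp

theorem summable_laguerreGenArray (hα : -1 < α) {r : ℝ} (hr : |r| < 1) (x : ℝ) :
    Summable (laguerreGenArray α x r) := by
  have hΓ (k m : ℕ) : 0 < Real.Gamma (m + (k + α + 1)) :=
    Real.Gamma_pos_of_pos (by linarith [Nat.cast_nonneg (α := ℝ) k, Nat.cast_nonneg (α := ℝ) m])
  have habs : (fun km => |laguerreGenArray α x r km|) = laguerreGenArray α (-|x|) |r| := by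
    ext ⟨k, m⟩
    simp only [laguerreGenArray, abs_mul, abs_div, abs_pow, abs_neg, neg_neg, Nat.abs_cast,
      abs_of_pos (Gamma_natCast_add_add_one_pos hα k), abs_of_pos (hΓ k m)]
  have hrow := hasSum_laguerreGenArray_row hα (r := |r|) (by rwa [abs_abs]) (-|x|)
  rw [← summable_abs_iff, habs, summable_prod_of_nonneg (habs ▸ fun _ => abs_nonneg _)]
  refine ⟨fun k => (hrow k).summable, ?_⟩
  simp only [(hrow _).tsum_eq]
  exact (Real.summable_pow_div_factorial _).mul_left _

theorem hasSum_laguerre (hα : -1 < α) {r : ℝ} (hr : |r| < 1) (x : ℝ) :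
    HasSum (fun n => laguerre α n x * r ^ n)
      ((1 - r) ^ (-(α + 1)) * Real.exp (-x * r / (1 - r))) := by
  have hsum := (summable_laguerreGenArray hα hr x).hasSum
  have hrows := hsum.prod_fiberwise (hasSum_laguerreGenArray_row hα hr x)
  simpa only [sum_antidiagonal_laguerreGenArray,
    hrows.unique ((hasSum_exp _).mul_left _)] using hasSum_antidiagonal hsum

/-- The generating function `G` of the Laguerre polynomials satisfies
`G x (w + r) = G x r * G (x / (1 - r)) (w / (1 - r))`, and the sums on the left-hand side are the
Taylor coefficients of `w ↦ G x (w + r)`. -/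
theorem hasSum_choose_mul_laguerre (hα : -1 < α) {r : ℝ} (hr : |r| < 1) (x : ℝ) (k : ℕ) :
    HasSum (fun m => (m + k).choose k * laguerre α (m + k) x * r ^ m)
      ((1 - r) ^ (-(α + 1)) * Real.exp (-x * r / (1 - r)) *
        (laguerre α k (x / (1 - r)) / (1 - r) ^ k)) := by
  have h1r : 0 < 1 - r := by linarith [(abs_lt.1 hr).2]
  refine hasSum_choose_mul_pow (d := fun k => (1 - r) ^ (-(α + 1)) * Real.exp (-x * r / (1 - r)) *
    (laguerre α k (x / (1 - r)) / (1 - r) ^ k)) (fun s hs => hasSum_laguerre hα hs x) hr ?_ k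
  have hsmall : ∀ᶠ w in 𝓝 (0 : ℝ), |w / (1 - r)| < 1 :=
    (by fun_prop : Continuous fun w : ℝ => |w / (1 - r)|).continuousAt.eventually_lt
      continuousAt_const (by simp)
  filter_upwards [hsmall] with w hw
  set s := w / (1 - r) with hs
  have h1s : 0 < 1 - s := by linarith [(abs_lt.1 hw).2]
  have hsplit : 1 - (w + r) = (1 - r) * (1 - s) := by rw [hs]; field_simp; ring
  have hexp : -x * (w + r) / (1 - (w + r)) =
      -x * r / (1 - r) + -(x / (1 - r)) * s / (1 - s) := by
    rw [hsplit, show w = (1 - r) * s by rw [hs]; field_simp]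
    field_simp
    ring
  convert! (hasSum_laguerre hα hw (x / (1 - r))).mul_left
    ((1 - r) ^ (-(α + 1)) * Real.exp (-x * r / (1 - r))) using 1
  · ext k
    rw [hs, div_pow]
    ring
  · rw [hexp, hsplit, Real.mul_rpow h1r.le h1s.le, Real.exp_add]
    ring

theorem summable_pow_div_Gamma (hα : -1 < α) (z : ℝ) :
    Summable fun k : ℕ => z ^ k / Real.Gamma (k + α + 1) := by
  refine summable_of_ratio_norm_eventually_le (r := 1 / 2) (by norm_num) ?_
  filter_upwards [tendsto_natCast_atTop_atTop.eventually_ge_atTop (2 * |z| - α - 1),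
    tendsto_natCast_atTop_atTop.eventually_gt_atTop (-α - 1)] with k hk hk0
  have hpos : 0 < (k : ℝ) + α + 1 := by linarith only [hk0]
  have hratio : |z| / (k + α + 1) ≤ 1 / 2 := by
    rw [div_le_div_iff₀ hpos two_pos]
    linarith
  rw [Gamma_natCast_succ_add_add_one hα, pow_succ', mul_div_mul_comm, norm_mul, norm_div,
    Real.norm_eq_abs, Real.norm_of_nonneg hpos.le]
  gcongr

theorem summable_pow_div_factorial_mul_Gamma (hα : -1 < α) (z : ℝ) :
    Summable fun k : ℕ => z ^ k / (k.factorial * Real.Gamma (k + α + 1)) := by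
  refine (summable_pow_div_Gamma hα z).norm.of_norm_bounded fun k => ?_
  have hΓ := Gamma_natCast_add_add_one_pos hα k
  have hfac : (1 : ℝ) ≤ k.factorial := mod_cast k.factorial_pos
  rw [norm_div, norm_div, norm_mul, Real.norm_natCast]
  gcongr
  · exact norm_pos_iff.2 hΓ.ne'
  · exact le_mul_of_one_le_left (norm_nonneg _) hfac

/-- The entire function `∑ z ^ k / (k! Γ(k + α + 1))`, related to the modified Bessel function by
`I_α(w) = (w / 2) ^ α * besselSeries α (w ^ 2 / 4)`. -/
def besselSeries (α z : ℝ) : ℝ := ∑' k : ℕ, z ^ k / (k.factorial * Real.Gamma (k + α + 1))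

theorem hasSum_laguerre_div_Gamma (hα : -1 < α) (u w : ℝ) :
    HasSum (fun k : ℕ => w ^ k * laguerre α k u / Real.Gamma (k + α + 1))
      (Real.exp w * besselSeries α (-u * w)) := by
  have hbessel := summable_pow_div_factorial_mul_Gamma hα (-u * w)
  have hprod := hasSum_antidiagonal <| hbessel.hasSum.mul (hasSum_exp w) <|
    summable_mul_of_summable_norm hbessel.norm (Real.summable_pow_div_factorial w).norm
  rw [mul_comm, besselSeries]
  convert! hprod using 1
  ext k
  rw [laguerre_eq_sum_antidiagonal, mul_left_comm,
    mul_div_cancel_left₀ _ (Gamma_natCast_add_add_one_pos hα k).ne', Finset.mul_sum]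
  refine Finset.sum_congr rfl fun ij hij => ?_
  rw [← mem_antidiagonal.1 hij, pow_add, mul_pow]
  ring

end Series

/-! ### The Hille–Hardy formula -/

section HilleHardy

variable {α q : ℝ}

/-- The Laguerre polynomial normalized in `L²(s ^ α e ^ (-s) ds)` on `(0, ∞)`. -/
def normalizedLaguerre (α : ℝ) (n : ℕ) (x : ℝ) : ℝ :=
  √(n.factorial / Real.Gamma (n + α + 1)) * laguerre α n x

/-- The kernel of the Laguerre semigroup; `q` stands for the exponential of minus the time. -/
def laguerreKernel (α q x y : ℝ) : ℝ :=
  ∑' n : ℕ, normalizedLaguerre α n x * normalizedLaguerre α n y * q ^ n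

theorem normalizedLaguerre_mul (hα : -1 < α) (n : ℕ) (x y : ℝ) :
    normalizedLaguerre α n x * normalizedLaguerre α n y =
      n.factorial / Real.Gamma (n + α + 1) * (laguerre α n x * laguerre α n y) := by
  have hΓ := Gamma_natCast_add_add_one_pos hα n
  rw [normalizedLaguerre, normalizedLaguerre, mul_mul_mul_comm, Real.mul_self_sqrt (by positivity)]

/-- The double series in `k` and `m` obtained from the series of `laguerreKernel` by expanding
`L_n(y)` in powers of `y` and collecting the terms with `k + m = n`. -/
def hilleHardyArray (α q x y : ℝ) (km : ℕ × ℕ) : ℝ :=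
  (-y * q) ^ km.1 / Real.Gamma (km.1 + α + 1) *
    ((km.2 + km.1).choose km.1 * laguerre α (km.2 + km.1) x * q ^ km.2)

theorem sum_antidiagonal_hilleHardyArray (hα : -1 < α) (q x y : ℝ) (n : ℕ) :
    ∑ km ∈ antidiagonal n, hilleHardyArray α q x y km =
      normalizedLaguerre α n x * normalizedLaguerre α n y * q ^ n := by
  rw [normalizedLaguerre_mul hα, laguerre_eq_sum_antidiagonal α n y, mul_left_comm,
    ← mul_assoc (_ / _), div_mul_cancel₀ _ (Gamma_natCast_add_add_one_pos hα n).ne',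
    Finset.mul_sum, Finset.mul_sum, Finset.sum_mul]
  refine Finset.sum_congr rfl fun km hkm => ?_
  rw [← mem_antidiagonal.1 hkm, hilleHardyArray, add_comm km.2, Nat.cast_add_choose, pow_add,
    mul_pow]
  simp only [div_eq_mul_inv, mul_inv]
  ring

theorem hasSum_hilleHardyArray_row (hα : -1 < α) (hq : |q| < 1) (x y : ℝ) (k : ℕ) :
    HasSum (fun m => hilleHardyArray α q x y (k, m))
      ((1 - q) ^ (-(α + 1)) * Real.exp (-x * q / (1 - q)) *
        ((-y * q / (1 - q)) ^ k * laguerre α k (x / (1 - q)) / Real.Gamma (k + α + 1))) := by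
  convert! (hasSum_choose_mul_laguerre hα hq x k).mul_left
    ((-y * q) ^ k / Real.Gamma (k + α + 1)) using 1
  rw [div_pow]
  ring

theorem abs_hilleHardyArray_le (hα : -1 < α) (hq : 0 ≤ q) (x y : ℝ) (km : ℕ × ℕ) :
    |hilleHardyArray α q x y km| ≤ hilleHardyArray α q (-|x|) (-|y|) km := by
  have hΓ := Gamma_natCast_add_add_one_pos hα km.1
  simp only [hilleHardyArray, abs_mul, abs_div, abs_pow, abs_neg, neg_neg, Nat.abs_cast,
    abs_of_nonneg hq, abs_of_pos hΓ]
  gcongr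
  exact abs_laguerre_le hα _ x

theorem summable_hilleHardyArray (hα : -1 < α) (hq0 : 0 ≤ q) (hq1 : q < 1) (x y : ℝ) :
    Summable (hilleHardyArray α q x y) := by
  have hrow := hasSum_hilleHardyArray_row hα (q := q) (by rwa [abs_of_nonneg hq0]) (-|x|) (-|y|)
  have hnonneg : 0 ≤ hilleHardyArray α q (-|x|) (-|y|) := fun km =>
    (abs_nonneg _).trans (abs_hilleHardyArray_le hα hq0 x y km)
  refine Summable.of_norm_bounded ((summable_prod_of_nonneg hnonneg).2
    ⟨fun k => (hrow k).summable, ?_⟩) (abs_hilleHardyArray_le hα hq0 x y)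
  simp only [(hrow _).tsum_eq]
  exact (hasSum_laguerre_div_Gamma hα _ _).summable.mul_left _

theorem hasSum_laguerreKernel (hα : -1 < α) (hq0 : 0 ≤ q) (hq1 : q < 1) (x y : ℝ) :
    HasSum (fun n => normalizedLaguerre α n x * normalizedLaguerre α n y * q ^ n)
      (laguerreKernel α q x y) := by
  refine Summable.hasSum ?_
  simpa only [sum_antidiagonal_hilleHardyArray hα] using
    (hasSum_antidiagonal (summable_hilleHardyArray hα hq0 hq1 x y).hasSum).summable

/-- The Hille–Hardy formula. -/
theorem laguerreKernel_eq (hα : -1 < α) (hq0 : 0 ≤ q) (hq1 : q < 1) (x y : ℝ) :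
    laguerreKernel α q x y = (1 - q) ^ (-(α + 1)) * Real.exp (-(q * (x + y) / (1 - q))) *
      besselSeries α (x * y * q / (1 - q) ^ 2) := by
  have h1q : 0 < 1 - q := by linarith
  have hsum := (summable_hilleHardyArray hα hq0 hq1 x y).hasSum
  have hrows := hsum.prod_fiberwise
    (hasSum_hilleHardyArray_row hα (by rwa [abs_of_nonneg hq0]) x y)
  have hdiag := hasSum_antidiagonal hsum
  simp only [sum_antidiagonal_hilleHardyArray hα] at hdiag
  rw [laguerreKernel, hdiag.tsum_eq,
    hrows.unique ((hasSum_laguerre_div_Gamma hα _ _).mul_left _), mul_assoc, mul_assoc,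
    ← mul_assoc (Real.exp _) (Real.exp _), ← Real.exp_add]
  congr 3
  · ring
  · field_simp

theorem besselSeries_pos (hα : -1 < α) {z : ℝ} (hz : 0 ≤ z) : 0 < besselSeries α z := by
  have hΓ := Gamma_natCast_add_add_one_pos hα
  refine (summable_pow_div_factorial_mul_Gamma hα z).tsum_pos (fun k => ?_) 0 ?_
  · have := hΓ k
    positivity
  · simpa only [pow_zero, Nat.factorial_zero, Nat.cast_one, one_mul, one_div, inv_pos] using hΓ 0

theorem laguerreKernel_pos (hα : -1 < α) (hq0 : 0 ≤ q) (hq1 : q < 1) {x y : ℝ} (hx : 0 ≤ x)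
    (hy : 0 ≤ y) : 0 < laguerreKernel α q x y := by
  have : 0 < 1 - q := by linarith
  have hbessel := besselSeries_pos hα (z := x * y * q / (1 - q) ^ 2) (by positivity)
  rw [laguerreKernel_eq hα hq0 hq1]
  positivity

theorem two_mul_le_add_sq_div {b : ℝ} (hb : 0 < b) (w : ℝ) : 2 * w ≤ b + w ^ 2 / b := by
  have hsq : b + w ^ 2 / b - 2 * w = (b - w) ^ 2 / b := by
    field_simp
    ring
  rw [← sub_nonneg, hsq]
  positivity

theorem add_one_le_max_mul_add (hα : -1 < α) (k : ℕ) :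
    (k : ℝ) + 1 ≤ max 1 (1 / (α + 1)) * (k + α + 1) := by
  have hC : 1 ≤ max 1 (1 / (α + 1)) * (α + 1) :=
    (div_le_iff₀ (by linarith)).1 (le_max_right 1 (1 / (α + 1)))
  nlinarith [le_max_left 1 (1 / (α + 1)), Nat.cast_nonneg (α := ℝ) k]

theorem mul_besselSeries_term_le (hα : -1 < α) (w : ℝ) (k : ℕ) :
    w * ((w ^ 2) ^ k / (k.factorial * Real.Gamma (k + (α + 1) + 1))) ≤
      max 1 (1 / (α + 1)) / 2 * ((w ^ 2) ^ k / (k.factorial * Real.Gamma (k + α + 1))) +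
        1 / 2 * ((w ^ 2) ^ (k + 1) / ((k + 1).factorial * Real.Gamma ((k + 1 : ℕ) + α + 1))) := by
  have := Gamma_natCast_add_add_one_pos hα k
  have hpos : 0 < (k : ℝ) + α + 1 := by linarith [Nat.cast_nonneg (α := ℝ) k]
  rw [← add_assoc (k : ℝ), Real.Gamma_add_one hpos.ne', Gamma_natCast_succ_add_add_one hα,
    Nat.factorial_succ]
  have hamgm := two_mul_le_add_sq_div (b := k + 1) (by positivity) w
  have hw : w ≤ max 1 (1 / (α + 1)) / 2 * (k + α + 1) + 1 / 2 * (w ^ 2 / (k + 1)) := by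
    linarith [add_one_le_max_mul_add hα k]
  calc _ = (w ^ 2) ^ k / (k.factorial * ((k + α + 1) * Real.Gamma (k + α + 1))) * w := by ring
    _ ≤ (w ^ 2) ^ k / (k.factorial * ((k + α + 1) * Real.Gamma (k + α + 1))) *
        (max 1 (1 / (α + 1)) / 2 * (k + α + 1) + 1 / 2 * (w ^ 2 / (k + 1))) := by gcongr
    _ = _ := by
      push_cast
      field_simp
      ring

theorem mul_besselSeries_add_one_le (hα : -1 < α) (w : ℝ) :
    w * besselSeries (α + 1) (w ^ 2) ≤ max 1 (1 / (α + 1)) * besselSeries α (w ^ 2) := by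
  have hs := summable_pow_div_factorial_mul_Gamma hα (w ^ 2)
  have hs' := summable_pow_div_factorial_mul_Gamma (α := α + 1) (by linarith) (w ^ 2)
  have hshift := (summable_nat_add_iff 1).2 hs
  have hpos := besselSeries_pos hα (sq_nonneg w)
  have htail := hs.tsum_eq_zero_add
  have hzero := Gamma_natCast_add_add_one_pos hα 0
  have hsum := (hs'.mul_left w).tsum_le_tsum (mul_besselSeries_term_le hα w)
    ((hs.mul_left _).add (hshift.mul_left _))
  rw [(hs.mul_left _).tsum_add (hshift.mul_left _), tsum_mul_left, tsum_mul_left, tsum_mul_left]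
    at hsum
  have hle : ∑' k : ℕ, (w ^ 2) ^ (k + 1) / ((k + 1).factorial *
      Real.Gamma ((k + 1 : ℕ) + α + 1)) ≤ besselSeries α (w ^ 2) := by
    rw [besselSeries, htail, le_add_iff_nonneg_left]
    positivity
  refine hsum.trans ?_
  have hC := le_max_left 1 (1 / (α + 1))
  change _ / 2 * besselSeries α (w ^ 2) + _ ≤ _
  nlinarith

theorem abs_mul_laguerreKernel_add_one_le (hα : -1 < α) {r : ℝ} (hr0 : 0 ≤ r) (hr1 : r < 1)
    (x y : ℝ) : |r * x * y * laguerreKernel (α + 1) (r ^ 2) (x ^ 2) (y ^ 2)| ≤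
      max 1 (1 / (α + 1)) * laguerreKernel α (r ^ 2) (x ^ 2) (y ^ 2) := by
  have hq1 : r ^ 2 < 1 := pow_lt_one₀ hr0 hr1 two_ne_zero
  have h1q : 0 < 1 - r ^ 2 := by linarith
  rw [abs_mul, abs_of_pos (laguerreKernel_pos (by linarith) (by positivity) hq1 (sq_nonneg x)
    (sq_nonneg y)), laguerreKernel_eq (by linarith) (by positivity) hq1,
    laguerreKernel_eq hα (by positivity) hq1]
  set w := |r * x * y| / (1 - r ^ 2) with hw
  have hsq : x ^ 2 * y ^ 2 * r ^ 2 / (1 - r ^ 2) ^ 2 = w ^ 2 := by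
    rw [hw, div_pow, sq_abs]
    ring
  rw [hsq, neg_add (α + 1), Real.rpow_add h1q, Real.rpow_neg_one]
  calc _ = (1 - r ^ 2) ^ (-(α + 1)) * Real.exp (-(r ^ 2 * (x ^ 2 + y ^ 2) / (1 - r ^ 2))) *
        (w * besselSeries (α + 1) (w ^ 2)) := by
        rw [hw]
        ring
    _ ≤ (1 - r ^ 2) ^ (-(α + 1)) * Real.exp (-(r ^ 2 * (x ^ 2 + y ^ 2) / (1 - r ^ 2))) *
        (max 1 (1 / (α + 1)) * besselSeries α (w ^ 2)) := by
        exact mul_le_mul_of_nonneg_left (mul_besselSeries_add_one_le hα w) (by positivity)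
    _ = _ := by ring

theorem exp_neg_mul_besselSeries_mul_le (hα : -1 < α) {s z : ℝ} (hs : 0 ≤ s) (hz : 0 ≤ z) :
    Real.exp (-s) * besselSeries α (s * z) ≤ ∑' k : ℕ, z ^ k / Real.Gamma (k + α + 1) := by
  rw [besselSeries, ← tsum_mul_left]
  refine ((summable_pow_div_factorial_mul_Gamma hα _).mul_left _).tsum_le_tsum (fun k => ?_)
    (summable_pow_div_Gamma hα z)
  have hΓ := Gamma_natCast_add_add_one_pos hα k
  calc Real.exp (-s) * ((s * z) ^ k / (k.factorial * Real.Gamma (k + α + 1)))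
      = Real.exp (-s) * (s ^ k / k.factorial) * (z ^ k / Real.Gamma (k + α + 1)) := by
        rw [mul_pow]
        ring
    _ ≤ Real.exp (-s) * Real.exp s * (z ^ k / Real.Gamma (k + α + 1)) := by
        gcongr
        exact Real.pow_div_factorial_le_exp s hs k
    _ = z ^ k / Real.Gamma (k + α + 1) := by
        rw [← Real.exp_add, neg_add_cancel, Real.exp_zero, one_mul]

theorem laguerreKernel_le (hα : -1 < α) {r x y : ℝ} (hq0 : 0 ≤ q) (hqr : q ≤ r) (hr : r < 1)
    (hx : 0 ≤ x) (hy : 0 ≤ y) : laguerreKernel α q x y ≤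
      (1 - r) ^ (-(α + 1)) * ∑' k : ℕ, (x / (1 - r)) ^ k / Real.Gamma (k + α + 1) := by
  have h1r : 0 < 1 - r := by linarith
  have h1q : 0 < 1 - q := by linarith
  have hz : 0 ≤ x / (1 - q) := by positivity
  have hs : 0 ≤ q * y / (1 - q) := by positivity
  rw [laguerreKernel_eq hα hq0 (hqr.trans_lt hr), mul_assoc,
    show x * y * q / (1 - q) ^ 2 = q * y / (1 - q) * (x / (1 - q)) by field_simp]
  refine mul_le_mul (Real.rpow_le_rpow_of_nonpos h1r (by linarith) (by linarith)) ?_ ?_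
    (by positivity)
  · calc _ ≤ Real.exp (-(q * y / (1 - q))) *
          besselSeries α (q * y / (1 - q) * (x / (1 - q))) := by
          gcongr
          · exact (besselSeries_pos hα (by positivity)).le
          · linarith
      _ ≤ ∑' k : ℕ, (x / (1 - q)) ^ k / Real.Gamma (k + α + 1) :=
          exp_neg_mul_besselSeries_mul_le hα hs hz
      _ ≤ ∑' k : ℕ, (x / (1 - r)) ^ k / Real.Gamma (k + α + 1) := by
          refine (summable_pow_div_Gamma hα _).tsum_le_tsum (fun k => ?_)
            (summable_pow_div_Gamma hα _)
          have hΓ := Gamma_natCast_add_add_one_pos hα k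
          gcongr
  · exact mul_nonneg (Real.exp_pos _).le (besselSeries_pos hα (by positivity)).le

end HilleHardy

/-! ### Orthogonality and the Chapman–Kolmogorov equation -/

section Orthogonality

variable {α : ℝ}

theorem integral_sq_pow_lam (hα : -1 < α) (k : ℕ) :
    ∫ x, (x ^ 2) ^ k ∂(lam (α + 1 / 2)) = Real.Gamma (k + α + 1) := by
  have : (0 : ℝ) ≤ k := k.cast_nonneg
  rw [lam, integral_withDensity_eq_integral_toReal_smul (by fun_prop) (by simp)]
  calc ∫ x : ℝ, (ENNReal.ofReal (|x| ^ (2 * (α + 1 / 2)) * Real.exp (-x ^ 2))).toReal •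
        (x ^ 2) ^ k
      = ∫ x : ℝ, (fun y : ℝ => y ^ (2 * (α + k) + 1) * Real.exp (-y ^ (2 : ℝ))) |x| := by
        refine integral_congr_ae ?_
        filter_upwards [Measure.ae_ne volume (0 : ℝ)] with x hx
        have hx' : 0 < |x| := abs_pos.2 hx
        rw [ENNReal.toReal_ofReal (by positivity), Real.rpow_two, sq_abs, smul_eq_mul, ← sq_abs x,
          ← pow_mul, ← Real.rpow_natCast |x| (2 * k), mul_right_comm, ← Real.rpow_add hx']
        push_cast
        ring_nf
    _ = 2 * ((1 / 2) * Real.Gamma ((2 * (α + k) + 1 + 1) / 2)) := by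
        rw [integral_comp_abs (f := fun y : ℝ => y ^ (2 * (α + k) + 1) *
          Real.exp (-y ^ (2 : ℝ))), integral_rpow_mul_exp_neg_rpow two_pos (by linarith)]
    _ = Real.Gamma (k + α + 1) := by ring_nf

theorem integrable_sq_pow_lam (hα : -1 < α) (k : ℕ) :
    Integrable (fun x => (x ^ 2) ^ k) (lam (α + 1 / 2)) :=
  Integrable.of_integral_ne_zero <| by
    rw [integral_sq_pow_lam hα]
    exact (Gamma_natCast_add_add_one_pos hα k).ne'

theorem integrable_eval_sq_lam (hα : -1 < α) (P : Polynomial ℝ) :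
    Integrable (fun x => P.eval (x ^ 2)) (lam (α + 1 / 2)) := by
  simp only [Polynomial.eval_eq_sum_range]
  exact integrable_finsetSum _ fun k _ => (integrable_sq_pow_lam hα k).const_mul _

theorem isFiniteMeasure_lam {μ : ℝ} (hμ : -(1 / 2) < μ) : IsFiniteMeasure (lam μ) := by
  have hInt := integrable_sq_pow_lam (α := μ - 1 / 2) (by linarith) 0
  simp only [pow_zero, sub_add_cancel] at hInt
  exact (integrable_const_iff_isFiniteMeasure one_ne_zero).1 hInt

theorem sum_neg_one_pow_mul_ascPochhammer (b : ℝ) {n j : ℕ} (hj : j ≤ n) :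
    ∑ k ∈ range (n + 1), (-1) ^ k / (k.factorial * (n - k).factorial) *
      (ascPochhammer ℝ j).eval (k + b) = if j = n then (-1) ^ n else 0 := by
  have hfwdDiff : ∑ k ∈ range (n + 1), (-1 : ℝ) ^ k / (k.factorial * (n - k).factorial) *
      (ascPochhammer ℝ j).eval (k + b) =
      (-1) ^ n / n.factorial * (fwdDiff (1 : ℝ))^[n] (ascPochhammer ℝ j).eval b := by
    rw [fwdDiff_iter_eq_sum_shift, Finset.mul_sum]
    refine Finset.sum_congr rfl fun k hk => ?_
    have hkn : k ≤ n := Nat.lt_succ_iff.1 (Finset.mem_range.1 hk)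
    have hsign : (-1 : ℝ) ^ n * (-1) ^ (n - k) = (-1) ^ k := by
      rw [← pow_add, show n + (n - k) = 2 * (n - k) + k by omega, pow_add, pow_mul, neg_one_sq,
        one_pow, one_mul]
    rw [nsmul_one, zsmul_eq_mul, add_comm b]
    push_cast
    rw [Nat.cast_choose ℝ hkn, ← hsign]
    field_simp
  rw [hfwdDiff]
  split_ifs with hjn
  · have hmonic := congrFun (Polynomial.fwdDiff_iter_degree_eq_factorial (ascPochhammer ℝ j)) b
    rw [ascPochhammer_natDegree, (monic_ascPochhammer ℝ j).leadingCoeff, one_smul, hjn] at hmonic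
    rw [hjn, hmonic]
    exact div_mul_cancel₀ _ (Nat.cast_ne_zero.2 n.factorial_ne_zero)
  · rw [Polynomial.fwdDiff_iter_eq_zero_of_degree_lt
      (by rw [ascPochhammer_natDegree]; exact lt_of_le_of_ne hj hjn)]
    simp

/-- The Laguerre polynomial `laguerre α n` as a `Polynomial`, which gives access to its degree and
leading coefficient. -/
def laguerrePolynomial (α : ℝ) (n : ℕ) : Polynomial ℝ :=
  ∑ k ∈ range (n + 1), Polynomial.monomial k ((-1) ^ k * (Real.Gamma (n + α + 1) /
    (Real.Gamma (k + α + 1) * ((n - k).factorial : ℝ))) / (k.factorial : ℝ))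

theorem eval_laguerrePolynomial (α : ℝ) (n : ℕ) (x : ℝ) :
    (laguerrePolynomial α n).eval x = laguerre α n x := by
  rw [laguerrePolynomial, Polynomial.eval_finsetSum, laguerre]
  refine Finset.sum_congr rfl fun k _ => ?_
  rw [Polynomial.eval_monomial]
  ring

theorem natDegree_laguerrePolynomial_le (α : ℝ) (n : ℕ) :
    (laguerrePolynomial α n).natDegree ≤ n :=
  Polynomial.natDegree_sum_le_of_forall_le _ _ fun _ hk =>
    (Polynomial.natDegree_monomial_le _).trans (Nat.lt_succ_iff.1 (Finset.mem_range.1 hk))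

theorem coeff_laguerrePolynomial_self (hα : -1 < α) (n : ℕ) :
    (laguerrePolynomial α n).coeff n = (-1) ^ n / n.factorial := by
  rw [laguerrePolynomial, Polynomial.finsetSum_coeff, Finset.sum_eq_single_of_mem n (by simp)
    fun k _ hk => Polynomial.coeff_monomial_of_ne _ hk.symm, Polynomial.coeff_monomial_same,
    Nat.sub_self, Nat.factorial_zero, Nat.cast_one, mul_one,
    div_self (Gamma_natCast_add_add_one_pos hα n).ne', mul_one]

theorem integral_laguerre_mul_sq_pow (hα : -1 < α) {n j : ℕ} (hj : j ≤ n) :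
    ∫ x, laguerre α n (x ^ 2) * (x ^ 2) ^ j ∂(lam (α + 1 / 2)) =
      if j = n then (-1) ^ n * Real.Gamma (n + α + 1) else 0 := by
  have hmoment (k : ℕ) : ∫ x, (x ^ 2) ^ (k + j) ∂(lam (α + 1 / 2)) =
      (ascPochhammer ℝ j).eval (k + (α + 1)) * Real.Gamma (k + α + 1) := by
    rw [integral_sq_pow_lam hα, ← add_assoc, ascPochhammer_eval_mul_Gamma
      (by linarith [Nat.cast_nonneg (α := ℝ) k])]
    push_cast
    ring_nf
  calc ∫ x, laguerre α n (x ^ 2) * (x ^ 2) ^ j ∂(lam (α + 1 / 2))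
      = ∫ x, ∑ k ∈ range (n + 1), (-1) ^ k * (Real.Gamma (n + α + 1) /
          (Real.Gamma (k + α + 1) * ((n - k).factorial : ℝ))) / (k.factorial : ℝ) *
            (x ^ 2) ^ (k + j) ∂(lam (α + 1 / 2)) := by
        simp only [laguerre, Finset.sum_mul, pow_add, mul_div_assoc', div_mul_eq_mul_div, mul_assoc]
    _ = Real.Gamma (n + α + 1) * ∑ k ∈ range (n + 1), (-1) ^ k /
          (k.factorial * (n - k).factorial) * (ascPochhammer ℝ j).eval (k + (α + 1)) := by
        rw [integral_finsetSum _ fun k _ => (integrable_sq_pow_lam hα (k + j)).const_mul _,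
          Finset.mul_sum]
        refine Finset.sum_congr rfl fun k _ => ?_
        have := (Gamma_natCast_add_add_one_pos hα k).ne'
        rw [integral_const_mul, hmoment]
        field_simp
    _ = _ := by
        rw [sum_neg_one_pow_mul_ascPochhammer _ hj, mul_ite, mul_zero, mul_comm]

theorem integral_laguerre_mul_eval (hα : -1 < α) {n : ℕ} {P : Polynomial ℝ}
    (hP : P.natDegree ≤ n) : ∫ x, laguerre α n (x ^ 2) * P.eval (x ^ 2) ∂(lam (α + 1 / 2)) =
      (-1) ^ n * Real.Gamma (n + α + 1) * P.coeff n := by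
  have hInt (k : ℕ) : Integrable (fun x => P.coeff k * (laguerre α n (x ^ 2) * (x ^ 2) ^ k))
      (lam (α + 1 / 2)) := by
    have := integrable_eval_sq_lam hα (laguerrePolynomial α n * Polynomial.X ^ k)
    simp only [Polynomial.eval_mul, Polynomial.eval_X_pow, eval_laguerrePolynomial] at this
    exact this.const_mul (P.coeff k)
  simp only [Polynomial.eval_eq_sum_range' (Nat.lt_succ_iff.2 hP), Finset.mul_sum,
    mul_left_comm (laguerre _ _ _)]
  rw [integral_finsetSum _ fun k _ => hInt k, Finset.sum_eq_single_of_mem n (by simp)]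
  · rw [integral_const_mul, integral_laguerre_mul_sq_pow hα le_rfl, if_pos rfl, mul_comm]
  · intro k hk hkn
    rw [integral_const_mul, integral_laguerre_mul_sq_pow hα
      (Nat.lt_succ_iff.1 (Finset.mem_range.1 hk)), if_neg hkn, mul_zero]

theorem integrable_normalizedLaguerre_mul (hα : -1 < α) (n m : ℕ) :
    Integrable (fun x => normalizedLaguerre α n (x ^ 2) * normalizedLaguerre α m (x ^ 2))
      (lam (α + 1 / 2)) := by
  simpa only [Polynomial.eval_mul, Polynomial.eval_C, eval_laguerrePolynomial,
    normalizedLaguerre] using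
    integrable_eval_sq_lam hα (Polynomial.C √(n.factorial / Real.Gamma (n + α + 1)) *
      laguerrePolynomial α n * (Polynomial.C √(m.factorial / Real.Gamma (m + α + 1)) *
        laguerrePolynomial α m))

theorem integral_normalizedLaguerre_mul (hα : -1 < α) (n m : ℕ) :
    ∫ x, normalizedLaguerre α n (x ^ 2) * normalizedLaguerre α m (x ^ 2) ∂(lam (α + 1 / 2)) =
      if n = m then 1 else 0 := by
  wlog hmn : m ≤ n generalizing n m
  · simp only [mul_comm (normalizedLaguerre α n _), eq_comm (a := n), this m n (by omega)]
  simp only [normalizedLaguerre, mul_mul_mul_comm _ (laguerre α n _)]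
  have hdeg := natDegree_laguerrePolynomial_le α m
  simp only [← eval_laguerrePolynomial α m]
  rw [integral_const_mul, integral_laguerre_mul_eval hα (hdeg.trans hmn)]
  split_ifs with h
  · have hΓ := Gamma_natCast_add_add_one_pos hα n
    rw [← h, coeff_laguerrePolynomial_self hα, Real.mul_self_sqrt (by positivity)]
    field_simp
    rw [← pow_mul, mul_comm, pow_mul, neg_one_sq, one_pow]
  · rw [Polynomial.coeff_eq_zero_of_natDegree_lt (hdeg.trans_lt (lt_of_le_of_ne hmn (Ne.symm h))),
      mul_zero, mul_zero]

section Orthonormal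

variable {X : Type*} [MeasurableSpace X] {π : Measure X}

theorem integral_abs_mul_le_one {f g : X → ℝ} (hfg : Integrable (fun x => f x * g x) π)
    (hf : ∫ x, f x * f x ∂π = 1) (hg : ∫ x, g x * g x ∂π = 1) : ∫ x, |f x * g x| ∂π ≤ 1 := by
  have hff : Integrable (fun x => f x * f x) π := .of_integral_ne_zero (by simp [hf])
  have hgg : Integrable (fun x => g x * g x) π := .of_integral_ne_zero (by simp [hg])
  calc ∫ x, |f x * g x| ∂π ≤ ∫ x, (f x * f x + g x * g x) / 2 ∂π := by
        refine integral_mono hfg.abs ((hff.add hgg).div_const 2) fun x => ?_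
        rw [abs_le']
        constructor <;> nlinarith [sq_nonneg (f x - g x), sq_nonneg (f x + g x)]
    _ = 1 := by
        rw [integral_div, integral_add hff hgg, hf, hg]
        norm_num

theorem integral_tsum_mul_tsum_of_orthonormal {ι : Type*} [Countable ι] [DecidableEq ι]
    {ψ : ι → X → ℝ} {a b : ι → ℝ} (hInt : ∀ i j, Integrable (fun x => ψ i x * ψ j x) π)
    (horth : ∀ i j, ∫ x, ψ i x * ψ j x ∂π = if i = j then 1 else 0)
    (ha : Summable a) (hb : Summable b) (haψ : ∀ x, Summable fun i => a i * ψ i x)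
    (hbψ : ∀ x, Summable fun i => b i * ψ i x) :
    ∫ x, (∑' i, a i * ψ i x) * (∑' i, b i * ψ i x) ∂π = ∑' i, a i * b i := by
  have hterm (ij : ι × ι) (x : X) : a ij.1 * ψ ij.1 x * (b ij.2 * ψ ij.2 x) =
      a ij.1 * b ij.2 * (ψ ij.1 x * ψ ij.2 x) := mul_mul_mul_comm _ _ _ _
  have hnorm : Summable fun ij : ι × ι => ∫ x, ‖a ij.1 * ψ ij.1 x * (b ij.2 * ψ ij.2 x)‖ ∂π := by
    refine Summable.of_nonneg_of_le (fun ij => integral_nonneg fun _ => norm_nonneg _)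
      (fun ij => ?_) (summable_mul_of_summable_norm ha.norm hb.norm).norm
    simp only [hterm, norm_mul (a ij.1 * b ij.2)]
    rw [integral_const_mul]
    exact mul_le_of_le_one_right (norm_nonneg _) (integral_abs_mul_le_one (hInt _ _)
      ((horth _ _).trans (if_pos rfl)) ((horth _ _).trans (if_pos rfl)))
  have hsum := hasSum_integral_of_summable_integral_norm
    (fun ij => by simpa only [hterm] using (hInt ij.1 ij.2).const_mul (a ij.1 * b ij.2)) hnorm
  simp only [hterm, integral_const_mul, horth, mul_ite, mul_one, mul_zero] at hsum
  simp only [tsum_mul_tsum_of_summable_norm (haψ _).norm (hbψ _).norm, hterm]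
  refine (hsum.prod_fiberwise fun i => ?_).tsum_eq.symm
  simpa only [if_pos] using hasSum_single i fun j hj => if_neg hj.symm

end Orthonormal

theorem summable_normalizedLaguerre_mul_pow (hα : -1 < α) {q : ℝ} (hq0 : 0 ≤ q) (hq1 : q < 1)
    (x : ℝ) : Summable fun n => normalizedLaguerre α n x * q ^ n := by
  refine (((hasSum_laguerreKernel hα hq0 hq1 x x).summable.add
    (summable_geometric_of_lt_one hq0 hq1)).div_const 2).of_norm_bounded fun n => ?_
  have hqn : 0 ≤ q ^ n := by positivity
  rw [norm_mul, Real.norm_of_nonneg hqn, ← add_one_mul, mul_div_right_comm, ← sq]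
  gcongr
  rw [Real.norm_eq_abs, ← sq_abs]
  linarith [two_mul_le_add_sq_div one_pos |normalizedLaguerre α n x|]

theorem integral_laguerreKernel_mul (hα : -1 < α) {q s : ℝ} (hq0 : 0 ≤ q) (hq1 : q < 1)
    (hs0 : 0 ≤ s) (hs1 : s < 1) (x z : ℝ) :
    ∫ y, laguerreKernel α q x (y ^ 2) * laguerreKernel α s z (y ^ 2) ∂(lam (α + 1 / 2)) =
      laguerreKernel α (q * s) x z := by
  have hsummable {r : ℝ} (hr0 : 0 ≤ r) (hr1 : r < 1) (u y : ℝ) :=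
    (hasSum_laguerreKernel hα hr0 hr1 u (y ^ 2)).summable
  simp only [mul_right_comm _ (normalizedLaguerre α _ (_ ^ 2))] at hsummable
  simp only [laguerreKernel, mul_right_comm _ (normalizedLaguerre α _ (_ ^ 2))]
  rw [integral_tsum_mul_tsum_of_orthonormal (integrable_normalizedLaguerre_mul hα)
    (integral_normalizedLaguerre_mul hα) (summable_normalizedLaguerre_mul_pow hα hq0 hq1 x)
    (summable_normalizedLaguerre_mul_pow hα hs0 hs1 z) (hsummable hq0 hq1 x)
    (hsummable hs0 hs1 z)]
  simp only [mul_pow, mul_mul_mul_comm]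

theorem integral_laguerreKernel (hα : -1 < α) {q : ℝ} (hq0 : 0 ≤ q) (hq1 : q < 1) (x : ℝ) :
    ∫ y, laguerreKernel α q x (y ^ 2) ∂(lam (α + 1 / 2)) = 1 := by
  have hpos := laguerreKernel_pos hα le_rfl one_pos le_rfl le_rfl
  have hzero (u v : ℝ) : laguerreKernel α 0 u v = laguerreKernel α 0 0 0 := by
    simp [laguerreKernel_eq hα le_rfl one_pos]
  have hCK := integral_laguerreKernel_mul hα hq0 hq1 le_rfl one_pos x 0
  simp only [mul_zero, hzero 0 (_ ^ 2), hzero x 0, integral_mul_const] at hCK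
  exact (mul_eq_right₀ hpos.ne').1 hCK

end Orthogonality

/-! ### The kernel of the generalized Ornstein–Uhlenbeck semigroup -/

section OUKernel

variable {μ t : ℝ}

/-- The kernel of the generalized Ornstein–Uhlenbeck semigroup restricted to even functions. -/
def evenKernel (μ t x y : ℝ) : ℝ :=
  laguerreKernel (μ - 1 / 2) (Real.exp (-t) ^ 2) (x ^ 2) (y ^ 2)

theorem exp_neg_sq_lt_one (ht : 0 < t) : Real.exp (-t) ^ 2 < 1 :=
  pow_lt_one₀ (Real.exp_pos _).le (Real.exp_lt_one_iff.2 (neg_neg_of_pos ht)) two_ne_zero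

theorem kernelTerm_even (hμ : -(1 / 2) < μ) (t x y : ℝ) (m : ℕ) :
    kernelTerm μ t x y (2 * m) = normalizedLaguerre (μ - 1 / 2) m (x ^ 2) *
      normalizedLaguerre (μ - 1 / 2) m (y ^ 2) * (Real.exp (-t) ^ 2) ^ m := by
  have hexp : Real.exp (-((2 * m : ℕ) * t)) = (Real.exp (-t) ^ 2) ^ m := by
    rw [← pow_mul, ← Real.exp_nat_mul]; push_cast; ring_nf
  have hindex : (m : ℝ) + μ + 1 / 2 = m + (μ - 1 / 2) + 1 := by ring
  have hΓ₀ := (Real.Gamma_pos_of_pos (by linarith : 0 < μ + 1 / 2)).ne'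
  have hΓ := (Gamma_natCast_add_add_one_pos (by linarith : -1 < μ - 1 / 2) m).ne'
  have hsign : (-1 : ℝ) ^ m * (-1) ^ m = 1 := by rw [← mul_pow]; simp
  rw [kernelTerm, genFactorial, genHermite, genHermite, if_pos (even_two_mul m),
    if_pos (even_two_mul m), if_pos (even_two_mul m), Nat.mul_div_cancel_left m two_pos, hexp,
    hindex, normalizedLaguerre_mul (by linarith)]
  generalize Real.Gamma (μ + 1 / 2) = Γ₀ at hΓ₀ ⊢
  generalize μ - 1 / 2 = α at hΓ ⊢
  generalize (-1 : ℝ) ^ m = ε at hsign ⊢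
  field_simp
  linear_combination laguerre α m (x ^ 2) * laguerre α m (y ^ 2) * hsign

theorem kernelTerm_odd (hμ : -(1 / 2) < μ) (t x y : ℝ) (m : ℕ) :
    kernelTerm μ t x y (2 * m + 1) =
      Real.exp (-t) * x * y * (normalizedLaguerre (μ + 1 / 2) m (x ^ 2) *
        normalizedLaguerre (μ + 1 / 2) m (y ^ 2) * (Real.exp (-t) ^ 2) ^ m) := by
  have hexp : Real.exp (-((2 * m + 1 : ℕ) * t)) = Real.exp (-t) * (Real.exp (-t) ^ 2) ^ m := by
    rw [← pow_mul, ← Real.exp_nat_mul, ← Real.exp_add]; push_cast; ring_nf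
  have hindex : (m : ℝ) + μ + 3 / 2 = m + (μ + 1 / 2) + 1 := by ring
  have hodd : ¬Even (2 * m + 1) := Nat.not_even_bit1 m
  have hΓ₀ := (Real.Gamma_pos_of_pos (by linarith : 0 < μ + 1 / 2)).ne'
  have hΓ := (Gamma_natCast_add_add_one_pos (by linarith : -1 < μ + 1 / 2) m).ne'
  have hsign : (-1 : ℝ) ^ m * (-1) ^ m = 1 := by rw [← mul_pow]; simp
  rw [kernelTerm, genFactorial, genHermite, genHermite, if_neg hodd, if_neg hodd, if_neg hodd,
    show (2 * m + 1) / 2 = m by omega, hexp, hindex, normalizedLaguerre_mul (by linarith)]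
  generalize Real.Gamma (μ + 1 / 2) = Γ₀ at hΓ₀ ⊢
  generalize μ + 1 / 2 = α at hΓ ⊢
  generalize (-1 : ℝ) ^ m = ε at hsign ⊢
  field_simp
  linear_combination x * laguerre α m (x ^ 2) * y * laguerre α m (y ^ 2) * hsign

theorem hasSum_kernelTerm (hμ : -(1 / 2) < μ) (ht : 0 < t) (x y : ℝ) :
    HasSum (kernelTerm μ t x y) (evenKernel μ t x y + Real.exp (-t) * x * y *
      laguerreKernel (μ + 1 / 2) (Real.exp (-t) ^ 2) (x ^ 2) (y ^ 2)) := by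
  have hq := exp_neg_sq_lt_one ht
  refine HasSum.even_add_odd ?_ ?_
  · simp only [kernelTerm_even hμ]
    exact hasSum_laguerreKernel (by linarith) (by positivity) hq _ _
  · simp only [kernelTerm_odd hμ]
    exact (hasSum_laguerreKernel (by linarith) (by positivity) hq _ _).mul_left _

theorem evenKernel_pos (hμ : -(1 / 2) < μ) (ht : 0 < t) (x y : ℝ) : 0 < evenKernel μ t x y :=
  laguerreKernel_pos (by linarith) (by positivity) (exp_neg_sq_lt_one ht) (sq_nonneg x)
    (sq_nonneg y)

theorem evenKernel_comm (μ t x y : ℝ) : evenKernel μ t x y = evenKernel μ t y x :=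
  tsum_congr fun _ => by rw [mul_comm (normalizedLaguerre _ _ _)]

/-- A constant with which the even part of the kernel dominates the kernel. -/
def evenBound (μ : ℝ) : ℝ≥0 := 1 + max 1 (1 / (μ + 1 / 2)).toNNReal

theorem coe_evenBound (μ : ℝ) : (evenBound μ : ℝ) = 1 + max 1 (1 / (μ + 1 / 2)) := by
  rw [evenBound, NNReal.coe_add, NNReal.coe_max, NNReal.coe_one, Real.coe_toNNReal', max_comm _ 0,
    ← max_assoc, max_eq_left zero_le_one]

theorem abs_kernel_le (hμ : -(1 / 2) < μ) (ht : 0 < t) (x y : ℝ) :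
    |kernel μ t x y| ≤ evenBound μ * evenKernel μ t x y := by
  have hodd := abs_mul_laguerreKernel_add_one_le (α := μ - 1 / 2) (by linarith)
    (Real.exp_pos (-t)).le (Real.exp_lt_one_iff.2 (neg_neg_of_pos ht)) x y
  rw [show μ - 1 / 2 + 1 = μ + 1 / 2 by ring] at hodd
  rw [kernel, (hasSum_kernelTerm hμ ht x y).tsum_eq, coe_evenBound, add_mul, one_mul]
  exact (abs_add_le _ _).trans (add_le_add (abs_of_pos (evenKernel_pos hμ ht x y)).le hodd)

theorem exists_evenKernel_le {t₀ : ℝ} (hμ : -(1 / 2) < μ) (ht₀ : 0 < t₀) (x : ℝ) :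
    ∃ M : ℝ, ∀ t, t₀ ≤ t → ∀ y, evenKernel μ t x y ≤ M := by
  refine ⟨_, fun t ht y => laguerreKernel_le (by linarith) (by positivity) ?_
    (exp_neg_sq_lt_one ht₀) (sq_nonneg x) (sq_nonneg y)⟩
  gcongr

theorem exists_abs_kernel_le {t₀ : ℝ} (hμ : -(1 / 2) < μ) (ht₀ : 0 < t₀) (x : ℝ) :
    ∃ M : ℝ, ∀ t, t₀ ≤ t → ∀ y, |kernel μ t x y| ≤ M := by
  obtain ⟨M, hM⟩ := exists_evenKernel_le hμ ht₀ x
  exact ⟨evenBound μ * M, fun t ht y => (abs_kernel_le hμ (ht₀.trans_le ht) x y).trans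
    (mul_le_mul_of_nonneg_left (hM t ht y) (evenBound μ).coe_nonneg)⟩

@[fun_prop]
theorem measurable_laguerre (α : ℝ) (n : ℕ) : Measurable (laguerre α n) := by
  unfold laguerre
  fun_prop

theorem measurable_evenKernel (μ t : ℝ) :
    Measurable (Function.uncurry (evenKernel μ t)) := by
  refine Measurable.tsum fun n => ?_
  unfold normalizedLaguerre
  fun_prop

theorem measurable_kernel (μ t : ℝ) : Measurable (Function.uncurry (kernel μ t)) := by
  refine Measurable.tsum fun n => ?_
  unfold kernelTerm genHermite
  split_ifs <;> fun_prop

theorem continuousAt_kernel (hμ : -(1 / 2) < μ) (ht : 0 < t) (x y : ℝ) :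
    ContinuousAt (fun s => kernel μ s x y) t := by
  have hsummable := (hasSum_kernelTerm hμ (half_pos ht) x y).summable.norm
  have hcont : ContinuousOn (fun s => kernel μ s x y) (Set.Ioi (t / 2)) := by
    refine continuousOn_tsum (fun n => ?_) hsummable fun n s hs => ?_
    · unfold kernelTerm
      fun_prop
    · have : t / 2 ≤ s := hs.le
      rw [kernelTerm, kernelTerm, norm_mul, norm_mul _ (Real.exp _), Real.norm_of_nonneg
        (Real.exp_pos _).le, Real.norm_of_nonneg (Real.exp_pos _).le]
      gcongr
  exact hcont.continuousAt (Ioi_mem_nhds (half_lt_self ht))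

theorem integral_evenKernel (hμ : -(1 / 2) < μ) (ht : 0 < t) (x : ℝ) :
    ∫ y, evenKernel μ t x y ∂lam μ = 1 := by
  simpa only [sub_add_cancel] using! integral_laguerreKernel (α := μ - 1 / 2) (by linarith)
    (sq_nonneg _) (exp_neg_sq_lt_one ht) (x ^ 2)

theorem integral_evenKernel_mul {s : ℝ} (hμ : -(1 / 2) < μ) (hs : 0 < s) (ht : 0 < t) (x z : ℝ) :
    ∫ y, evenKernel μ s x y * evenKernel μ t y z ∂lam μ = evenKernel μ (s + t) x z := by
  simp only [evenKernel_comm μ t _ z]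
  rw [evenKernel, neg_add, Real.exp_add, mul_pow]
  simpa only [sub_add_cancel] using! integral_laguerreKernel_mul (α := μ - 1 / 2) (by linarith)
    (sq_nonneg _) (exp_neg_sq_lt_one hs) (sq_nonneg _) (exp_neg_sq_lt_one ht) (x ^ 2) (z ^ 2)

theorem lintegral_ofReal_eq_ofReal_integral_of_pos {X : Type*} [MeasurableSpace X]
    {π : Measure X} {f : X → ℝ} (hf : 0 ≤ f) (hpos : 0 < ∫ x, f x ∂π) :
    ∫⁻ x, ENNReal.ofReal (f x) ∂π = ENNReal.ofReal (∫ x, f x ∂π) :=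
  (ofReal_integral_eq_lintegral_ofReal (Integrable.of_integral_ne_zero hpos.ne')
    (ae_of_all _ hf)).symm

theorem lintegral_evenKernel (hμ : -(1 / 2) < μ) (ht : 0 < t) (x : ℝ) :
    ∫⁻ y, ENNReal.ofReal (evenKernel μ t x y) ∂lam μ = 1 := by
  have hInt := integral_evenKernel hμ ht x
  rw [lintegral_ofReal_eq_ofReal_integral_of_pos (fun y => (evenKernel_pos hμ ht x y).le)
    (hInt ▸ one_pos), hInt, ENNReal.ofReal_one]

theorem lintegral_evenKernel_mul {s : ℝ} (hμ : -(1 / 2) < μ) (hs : 0 < s) (ht : 0 < t) (x z : ℝ) :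
    ∫⁻ y, ENNReal.ofReal (evenKernel μ s x y) * ENNReal.ofReal (evenKernel μ t y z) ∂lam μ =
      ENNReal.ofReal (evenKernel μ (s + t) x z) := by
  have hInt := integral_evenKernel_mul hμ hs ht x z
  simp only [← ENNReal.ofReal_mul (evenKernel_pos hμ hs _ _).le]
  rw [lintegral_ofReal_eq_ofReal_integral_of_pos
    (fun y => (mul_pos (evenKernel_pos hμ hs x y) (evenKernel_pos hμ ht y z)).le)
    (hInt ▸ evenKernel_pos hμ (add_pos hs ht) x z), hInt]

end OUKernel

instance sFinite_lam (μ : ℝ) : SFinite (lam μ) := by unfold lam; infer_instance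

/-- The Markov kernel `evenKernel μ t x y dλ_μ(y)`. -/
def evenMarkov (μ t : ℝ) : Kernel ℝ ℝ :=
  densityKernel (lam μ) fun x y => ENNReal.ofReal (evenKernel μ t x y)

theorem isSymmetricMarkovSemigroup_evenMarkov {μ : ℝ} (hμ : -(1 / 2) < μ) :
    IsSymmetricMarkovSemigroup (evenMarkov μ) (lam μ) where
  isMarkovKernel t ht := ⟨fun x => ⟨by
    rw [evenMarkov, densityKernel_apply' (measurable_evenKernel μ t).ennreal_ofReal,
      setLIntegral_univ, lintegral_evenKernel hμ ht]⟩⟩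
  isReversible t _ := isReversible_densityKernel (measurable_evenKernel μ t).ennreal_ofReal
    fun x y => by rw [evenKernel_comm]
  comp_eq_add s t hs ht := by
    rw [evenMarkov, evenMarkov, densityKernel_comp (measurable_evenKernel μ t).ennreal_ofReal
      (measurable_evenKernel μ s).ennreal_ofReal, evenMarkov, add_comm]
    simp only [lintegral_evenKernel_mul hμ ht hs]

/-! ### The maximal function -/

section Maximal

variable {𝕜 : Type*} [RCLike 𝕜] {μ t : ℝ} {f g : ℝ → 𝕜}

theorem integrable_kernel_smul (hμ : -(1 / 2) < μ) (ht : 0 < t) (hf : Integrable f (lam μ))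
    (x : ℝ) : Integrable (fun y => kernel μ t x y • f y) (lam μ) := by
  obtain ⟨M, hM⟩ := exists_abs_kernel_le hμ ht x
  have hmeas : Measurable (kernel μ t x) := (measurable_kernel μ t).of_uncurry_left
  exact hf.bdd_smul (φ := kernel μ t x) M hmeas.aestronglyMeasurable (ae_of_all _ (hM t le_rfl))

theorem continuousAt_semigroup (hμ : -(1 / 2) < μ) (ht : 0 < t) (hf : Integrable f (lam μ))
    (x : ℝ) : ContinuousAt (fun s => semigroup μ s f x) t := by
  obtain ⟨M, hM⟩ := exists_abs_kernel_le hμ (half_pos ht) x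
  have hnear : ∀ᶠ s in 𝓝 t, t / 2 < s := Ioi_mem_nhds (half_lt_self ht)
  refine continuousAt_of_dominated (bound := fun y => M * ‖f y‖) ?_ ?_ (hf.norm.const_mul _)
    (ae_of_all _ fun y => (continuousAt_kernel hμ ht x y).smul continuousAt_const)
  · filter_upwards [hnear] with s hs
    exact (integrable_kernel_smul hμ ((half_pos ht).trans hs) hf x).aestronglyMeasurable
  · filter_upwards [hnear] with s hs
    refine ae_of_all _ fun y => ?_
    rw [norm_smul]
    gcongr
    exact hM s hs.le y

theorem tendsto_dyadic {t : ℝ} (ht : 0 ≤ t) :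
    Tendsto (fun j : ℕ => ((⌊t * 2 ^ j⌋₊ : ℝ) + 1) / 2 ^ j) atTop (𝓝 t) := by
  have hpow : Tendsto (fun j : ℕ => (2 : ℝ) ^ j) atTop atTop :=
    tendsto_pow_atTop_atTop_of_one_lt one_lt_two
  simpa only [add_div, one_div, add_zero, Function.comp_def, Pi.inv_apply] using
    ((tendsto_nat_floor_mul_div_atTop ht).comp hpow).add hpow.inv_tendsto_atTop

theorem maximal_eq_iSup_dyadic (hμ : -(1 / 2) < μ) (hf : Integrable f (lam μ)) (x : ℝ) :
    maximal μ f x = ⨆ (j : ℕ) (n : ℕ), ‖semigroup μ ((n + 1) / 2 ^ j) f x‖ₑ := by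
  refine le_antisymm (iSup₂_le fun t ht => ?_) (iSup₂_le fun j n => ?_)
  · refine le_of_tendsto ((continuousAt_semigroup hμ ht hf x).enorm.tendsto.comp
      (tendsto_dyadic ht.le)) (Eventually.of_forall fun j => ?_)
    exact le_iSup₂ (f := fun j n : ℕ => ‖semigroup μ ((n + 1) / 2 ^ j) f x‖ₑ) j ⌊t * 2 ^ j⌋₊
  · exact le_iSup₂ (f := fun (t : ℝ) (_ : 0 < t) => ‖semigroup μ t f x‖ₑ)
      ((n + 1) / 2 ^ j) (by positivity)

theorem stronglyMeasurable_semigroup (hf : StronglyMeasurable f) :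
    StronglyMeasurable (semigroup μ t f) :=
  ((measurable_kernel μ t).stronglyMeasurable.smul
    (hf.comp_measurable measurable_snd)).integral_prod_right'

theorem maximal_congr (h : f =ᵐ[lam μ] g) : maximal μ f = maximal μ g := by
  have hsemigroup (t x : ℝ) : semigroup μ t f x = semigroup μ t g x :=
    integral_congr_ae (h.mono fun y hy => congrArg (kernel μ t x y • ·) hy)
  simp only [funext_iff, maximal, hsemigroup, implies_true]

theorem measurable_maximal (hμ : -(1 / 2) < μ) (hf : Integrable f (lam μ)) :
    Measurable (maximal μ f) := by
  have hmk := hf.aestronglyMeasurable.ae_eq_mk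
  rw [maximal_congr hmk, funext (maximal_eq_iSup_dyadic hμ (hf.congr hmk))]
  exact .iSup fun j => .iSup fun n => (stronglyMeasurable_semigroup
    hf.aestronglyMeasurable.stronglyMeasurable_mk).enorm

theorem enorm_semigroup_le (hμ : -(1 / 2) < μ) (ht : 0 < t) (hf : Measurable f) (x : ℝ) :
    ‖semigroup μ t f x‖ₑ ≤ evenBound μ * avg (evenMarkov μ t) (fun y => ‖f y‖ₑ) x := by
  rw [evenMarkov, avg_densityKernel (measurable_evenKernel μ t).ennreal_ofReal hf.enorm,
    ← lintegral_const_mul' _ _ ENNReal.coe_ne_top]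
  refine (enorm_integral_le_lintegral_enorm _).trans (lintegral_mono fun y => ?_)
  rw [enorm_smul, ← mul_assoc]
  gcongr
  rw [Real.enorm_eq_ofReal_abs, ← ENNReal.ofReal_coe_nnreal,
    ← ENNReal.ofReal_mul (evenBound μ).coe_nonneg]
  exact ENNReal.ofReal_le_ofReal (abs_kernel_le hμ ht x y)

theorem maximal_le_dyadicMaximal (hμ : -(1 / 2) < μ) (hf : Integrable f (lam μ))
    (hfm : Measurable f) (x : ℝ) :
    maximal μ f x ≤ evenBound μ * dyadicMaximal (evenMarkov μ) (fun y => ‖f y‖ₑ) x := by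
  rw [maximal_eq_iSup_dyadic hμ hf]
  refine iSup₂_le fun j n => (enorm_semigroup_le hμ (by positivity) hfm x).trans ?_
  gcongr
  exact le_iSup₂ (f := fun j n : ℕ => avg (evenMarkov μ ((n + 1) / 2 ^ j)) (fun y => ‖f y‖ₑ) x) j n

theorem eLpNorm_maximal_le (hμ : -(1 / 2) < μ) {p q : ℝ≥0∞} [p.HolderConjugate q] (hp : 1 < p)
    (hf : Integrable f (lam μ)) :
    eLpNorm (maximal μ f) p (lam μ) ≤ evenBound μ * q * eLpNorm f p (lam μ) := by
  have := isFiniteMeasure_lam hμ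
  have hmk := hf.aestronglyMeasurable.ae_eq_mk
  have hmeas := hf.aestronglyMeasurable.stronglyMeasurable_mk.measurable
  rw [maximal_congr hmk, eLpNorm_congr_ae hmk, mul_assoc,
    ← eLpNorm_enorm (hf.aestronglyMeasurable.mk f)]
  calc eLpNorm (maximal μ (hf.aestronglyMeasurable.mk f)) p (lam μ)
      ≤ evenBound μ * eLpNorm (dyadicMaximal (evenMarkov μ)
          fun y => ‖hf.aestronglyMeasurable.mk f y‖ₑ) p (lam μ) :=
        eLpNorm_le_mul_eLpNorm_of_ae_le_mul'
          (ae_of_all _ (maximal_le_dyadicMaximal hμ (hf.congr hmk) hmeas)) p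
    _ ≤ _ := by
        gcongr
        exact (isSymmetricMarkovSemigroup_evenMarkov hμ).eLpNorm_dyadicMaximal_le hp hmeas.enorm

end Maximal

end GenOU

end

/-- For `μ > -1/2` and `1 < p ≤ ∞` the maximal operator is bounded on `L^p(dλ_μ)`. The series for
the kernel and the integrals for `T_μ^t f` converge absolutely, so no default value enters. -/
theorem corollary2p2 {𝕜 : Type*} [RCLike 𝕜] (μ : ℝ) (hμ : -(1 / 2) < μ)
    (p : ℝ≥0∞) (hp : 1 < p) :
    (∀ t : ℝ, 0 < t → ∀ x y : ℝ, Summable (GenOU.kernelTerm μ t x y)) ∧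
    ∃ C : ℝ≥0, ∀ f : ℝ → 𝕜, MemLp f p (GenOU.lam μ) →
      (∀ t : ℝ, 0 < t → ∀ x : ℝ,
        Integrable (fun y => GenOU.kernel μ t x y • f y) (GenOU.lam μ)) ∧
      AEMeasurable (GenOU.maximal μ f) (GenOU.lam μ) ∧
      eLpNorm (GenOU.maximal μ f) p (GenOU.lam μ) ≤ C * eLpNorm f p (GenOU.lam μ) := by
  have := GenOU.isFiniteMeasure_lam hμ
  have hpq : p.HolderConjugate p.conjExponent := .conjExponent hp.le
  have hq : p.conjExponent ≠ ∞ :=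
    (ENNReal.HolderConjugate.ne_top_iff_ne_one p.conjExponent p).2 hp.ne'
  refine ⟨fun t ht x y => (GenOU.hasSum_kernelTerm hμ ht x y).summable,
    GenOU.evenBound μ * p.conjExponent.toNNReal, fun f hf => ?_⟩
  have hInt := hf.integrable hp.le
  refine ⟨fun t ht x => GenOU.integrable_kernel_smul hμ ht hInt x,
    (GenOU.measurable_maximal hμ hInt).aemeasurable, ?_⟩
  rw [ENNReal.coe_mul, ENNReal.coe_toNNReal hq]
  exact GenOU.eLpNorm_maximal_le hμ hp hInt
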